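/- **Setting.** A generalized counter is a triple $C=(U,G,F_-)$, where $U$ is a group, $G\subset U$ is a finite set, and, with $G_{inv}=\{X\in U\mid X^{-1}\in G\}$ and with $S^*$ denoting the set of all products of one or more elements of $S$, the set $F_-\subset U$ satisfies $F_-\cap G^*=\emptyset$ and $G_{inv}^*\subseteq F_-$, and moreover $G^*\cap G_{inv}^*=\emptyset$. A one-way partially blind deterministic automaton with counter $C$, a 1PBDC($C$) machine, has a finite set $Q$ of states, a start state, a set $F\subseteq Q$ of accepting states, a finite input alphabet $\Sigma$, and a transition function $\delta: Q\times(\Sigma\cup\{¢,\$\})\to Q\times\{0,+1\}\times(G\cup G_{inv})$. It starts in the start state on the left end-marker of the tape $¢\,w\,\$$ with the identity of $U$ in the counter. If $\delta(q,\sigma)=(q',d,X)$ and the counter contains $\Omega$, then a step in state $q$ on symbol $\sigma$ changes the state to $q'$, moves the head by $d$ and replaces $\Omega$ by $X\Omega$; if $\Omega\in F_-$, the machine crashes (there is no step). The word $w$ is accepted if the head eventually moves past $\$$ with the machine in an accepting state and the identity in the counter. Let $\mathcal L(\mathrm{1PBDC}(C))$ be the class of the languages, over arbitrary finite alphabets,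 that are recognized by such machines. Consider the following counters. * $C_{\mathbb Z}=(\mathbb Z,\{1\},\mathbb Z^-)$, where $\mathbb Z^-$ is the set of negative integers. * $C_{\mathbb R}(k)=(\mathbb R,\{\rho_1,\dots,\rho_k\},\mathbb R^-)$, where $\mathbb R$ is the additive group, $\rho_1,\dots,\rho_k$ are the square roots of $k$ distinct primes, and $\mathbb R^-$ is the set of negative reals; $\mathcal L(\mathrm{1PBDC}(C_{\mathbb R}(k)))$ is the union of the classes for all choices of the $k$ primes. * $C_{\mathbb M}(k)=(GL(m,\mathbb R),\{A_1,\dots,A_k\},F_-)$, a generalized counter with $k$ distinct generators and $F_-=\{X\in GL(m,\mathbb R)\mid \sqrt{\sum_{i,j}|X_{ij}|^2}<1\}$; $\mathcal L(\mathrm{1PBDC}(C_{\mathbb M}(k)))$ is the union of the classes for all such counters, of all dimensions $m$. **Theorem.** For every $k\ge 2$, $$\mathcal L(\mathrm{1PBDC}(C_{\mathbb Z}))\subsetneq \mathcal L(\mathrm{1PBDC}(C_{\mathbb R}(k)))\subsetneq \mathcal L(\mathrm{1PBDC}(C_{\mathbb M}(k))).$$ The language $\{a^nb^nc^n\mid n\in\mathbb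 N\}$ is in $\mathcal L(\mathrm{1PBDC}(C_{\mathbb R}(k)))$ and not in $\mathcal L(\mathrm{1PBDC}(C_{\mathbb Z}))$. For every finite alphabet $\Sigma$ with at least two letters and $\#\notin\Sigma$, the language $L_{pal}=\{x\#x^R\mid x\in\Sigma^*\}$ is in $\mathcal L(\mathrm{1PBDC}(C_{\mathbb M}(k)))$ and not in $\mathcal L(\mathrm{1PBDC}(C_{\mathbb R}(k)))$. Moreover, for each single choice of $k$ distinct primes, the class for the counter over the reals generated by their square roots contains $\{a^nb^nc^n\mid n\in\mathbb N\}$ and properly contains $\mathcal L(\mathrm{1PBDC}(C_{\mathbb Z}))$. -/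

import Mathlib

/-- A generalized counter `(U, G, F₋)` over a group `U`: `gen` is the finite generating set `G`
and `neg` is the set `F₋` of negative elements. The closures `G*` and `Gᵢₙᵥ*` are the sets of all
products of one or more elements of `G` and of `Gᵢₙᵥ`. -/
structure GeneralizedCounter (U : Type) [Group U] where
  gen : Finset U
  neg : Set U
  closure_disjoint :
    Disjoint (Subsemigroup.closure (gen : Set U) : Set U)
      (Subsemigroup.closure {X : U | X⁻¹ ∈ gen} : Set U)
  neg_disjoint : Disjoint neg (Subsemigroup.closure (gen : Set U) : Set U)
  inv_closure_subset : (Subsemigroup.closure {X : U | X⁻¹ ∈ gen} : Set U) ⊆ neg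

/-- The elements of `G ∪ Gᵢₙᵥ`: the increments and decrements that a machine can perform. -/
def GeneralizedCounter.Operation {U : Type} [Group U] (C : GeneralizedCounter U) : Type :=
  {X : U // X ∈ C.gen ∨ X⁻¹ ∈ C.gen}

/-- The symbols on the tape: input letters and the two end-markers. -/
inductive TapeSymbol (α : Type) : Type
  | leftEnd : TapeSymbol α
  | letter : α → TapeSymbol α
  | rightEnd : TapeSymbol α

/-- The moves of a one-way head. -/
inductive HeadMove : Type
  | stay : HeadMove
  | right : HeadMove

/-- A one-way partially blind deterministic automaton with the counter `C`, input alphabet `α` and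
set of states `Q`. The transition function gets no information about the counter. -/
structure OnePBDC {U : Type} [Group U] (C : GeneralizedCounter U) (α Q : Type) where
  start : Q
  accepting : Set Q
  trans : Q → TapeSymbol α → Q × HeadMove × C.Operation

/-- An instantaneous configuration: the state, the part of the tape from the scanned symbol to the
right end, and the content of the counter. -/
structure CounterConfig (U α Q : Type) where
  state : Q
  rest : List (TapeSymbol α)
  counter : U

namespace HeadMove

/-- The part of the tape from the head on after a move, where `σ` is the scanned symbol and `τ` is
the part of the tape to the right of it. -/
def apply {α : Type} (d : HeadMove) (σ : TapeSymbol α) (τ : List (TapeSymbol α)) :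
    List (TapeSymbol α) :=
  match d with
  | stay => σ :: τ
  | right => τ

end HeadMove

namespace OnePBDC

variable {U : Type} [Group U] {C : GeneralizedCounter U} {α Q : Type}

/-- One step of the computation. There is no step from a configuration whose counter is negative
(the machine crashes). The operation acts on the counter from the left. -/
inductive Step (M : OnePBDC C α Q) : CounterConfig U α Q → CounterConfig U α Q → Prop
  | mk (q : Q) (σ : TapeSymbol α) (τ : List (TapeSymbol α)) (Ω : U) (hΩ : Ω ∉ C.neg) :
      Step M ⟨q, σ :: τ, Ω⟩
        ⟨(M.trans q σ).1, (M.trans q σ).2.1.apply σ τ, (M.trans q σ).2.2.val * Ω⟩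

/-- The tape with input `w` between the end-markers. -/
def tape (w : List α) : List (TapeSymbol α) :=
  TapeSymbol.leftEnd :: (w.map TapeSymbol.letter ++ [TapeSymbol.rightEnd])

/-- Acceptance by final state and empty counter, after the whole tape has been scanned. -/
def Accepts (M : OnePBDC C α Q) (w : List α) : Prop :=
  ∃ q ∈ M.accepting,
    Relation.ReflTransGen M.Step ⟨M.start, tape w, 1⟩ ⟨q, [], 1⟩

/-- The language recognized by the machine. -/
def language (M : OnePBDC C α Q) : Language α :=
  {w | M.Accepts w}

end OnePBDC

/-- The languages over finite alphabets, where the alphabet with `n` letters is `Fin n`. -/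
abbrev FiniteAlphabetLanguage : Type := Σ n : ℕ, Language (Fin n)

/-- The class of the languages recognized by one-way partially blind deterministic automata with
the counter `C`. -/
def classOf {U : Type} [Group U] (C : GeneralizedCounter U) : Set FiniteAlphabetLanguage :=
  {L | ∃ (Q : Type) (_ : Finite Q) (M : OnePBDC C (Fin L.1) Q), M.language = L.2}

/-- The conventional counter `(ℤ, {1}, ℤ⁻)`. -/
def integerCounter : GeneralizedCounter (Multiplicative ℤ) :=
  have hpos : ∀ x ∈ Subsemigroup.closure
      (({Multiplicative.ofAdd 1} : Finset (Multiplicative ℤ)) : Set (Multiplicative ℤ)),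
      0 < x.toAdd := by
    intro x hx
    induction hx using Subsemigroup.closure_induction with
    | mem x hx =>
      simp only [Finset.coe_singleton, Set.mem_singleton_iff] at hx
      subst hx
      simp
    | mul x y _ _ hx hy => rw [toAdd_mul]; omega
  have hneg : ∀ x ∈ Subsemigroup.closure
      {X : Multiplicative ℤ | X⁻¹ ∈ ({Multiplicative.ofAdd 1} : Finset (Multiplicative ℤ))},
      x.toAdd < 0 := by
    intro x hx
    induction hx using Subsemigroup.closure_induction with
    | mem x hx =>
      simp only [Finset.mem_singleton, Set.mem_ofPred_eq] at hx
      have h := congrArg Multiplicative.toAdd hx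
      rw [toAdd_inv, toAdd_ofAdd] at h
      omega
    | mul x y _ _ hx hy => rw [toAdd_mul]; omega
  { gen := {Multiplicative.ofAdd 1}
    neg := {x | x.toAdd < 0}
    closure_disjoint := Set.disjoint_left.2 fun x h₁ h₂ => lt_asymm (hpos x h₁) (hneg x h₂)
    neg_disjoint := Set.disjoint_left.2 fun x h₁ h₂ => lt_asymm (hpos x h₂) h₁
    inv_closure_subset := hneg }

/-- The counter over the additive group of the reals that is generated by the square roots of the
primes in `P`; the negative elements are the negative reals. -/
noncomputable def realCounter (P : Finset ℕ) (hP : ∀ p ∈ P, p.Prime) :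
    GeneralizedCounter (Multiplicative ℝ) :=
  have hpos : ∀ x ∈ Subsemigroup.closure
      ((P.image fun p : ℕ => Multiplicative.ofAdd (Real.sqrt p) : Finset (Multiplicative ℝ)) :
        Set (Multiplicative ℝ)), 0 < x.toAdd := by
    intro x hx
    induction hx using Subsemigroup.closure_induction with
    | mem x hx =>
      obtain ⟨p, hp, rfl⟩ := Finset.mem_image.1 (Finset.mem_coe.1 hx)
      exact Real.sqrt_pos.2 (Nat.cast_pos.2 (hP p hp).pos)
    | mul x y _ _ hx hy => rw [toAdd_mul]; exact add_pos hx hy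
  have hneg : ∀ x ∈ Subsemigroup.closure
      {X : Multiplicative ℝ |
        X⁻¹ ∈ P.image fun p : ℕ => Multiplicative.ofAdd (Real.sqrt p)}, x.toAdd < 0 := by
    intro x hx
    induction hx using Subsemigroup.closure_induction with
    | mem x hx =>
      obtain ⟨p, hp, h⟩ := Finset.mem_image.1 hx
      have h' := congrArg Multiplicative.toAdd h
      rw [toAdd_inv, toAdd_ofAdd] at h'
      have := Real.sqrt_pos.2 (Nat.cast_pos.2 (hP p hp).pos : (0 : ℝ) < p)
      linarith
    | mul x y _ _ hx hy => rw [toAdd_mul]; exact add_neg hx hy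
  { gen := P.image fun p : ℕ => Multiplicative.ofAdd (Real.sqrt p)
    neg := {x | x.toAdd < 0}
    closure_disjoint := Set.disjoint_left.2 fun x h₁ h₂ => lt_asymm (hpos x h₁) (hneg x h₂)
    neg_disjoint := Set.disjoint_left.2 fun x h₁ h₂ => lt_asymm (hpos x h₂) h₁
    inv_closure_subset := hneg }

/-- The size `√(∑ᵢ ∑ⱼ |Xᵢⱼ|²)` of an invertible matrix. -/
noncomputable def matrixSize {m : ℕ} (X : Matrix.GeneralLinearGroup (Fin m) ℝ) : ℝ :=
  Real.sqrt (∑ i, ∑ j, |X.val i j| ^ 2)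

/-- `C` is a matrix counter with `k` generators: it is a generalized counter over `GL(m, ℝ)` whose
negative elements are the matrices of size less than `1`. -/
def IsMatrixCounter (k : ℕ) {m : ℕ}
    (C : GeneralizedCounter (Matrix.GeneralLinearGroup (Fin m) ℝ)) : Prop :=
  C.gen.card = k ∧ C.neg = {X | matrixSize X < 1}

/-- The class `𝓛(1PBDC(C_ℤ))`. -/
def integerCounterClass : Set FiniteAlphabetLanguage := classOf integerCounter

/-- The class `𝓛(1PBDC(C_ℝ(k)))`: languages recognized with some counter over the reals that is
generated by the square roots of `k` distinct primes. -/
def realCounterClass (k : ℕ) : Set FiniteAlphabetLanguage :=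
  {L | ∃ (P : Finset ℕ) (hP : ∀ p ∈ P, p.Prime), P.card = k ∧ L ∈ classOf (realCounter P hP)}

/-- The class `𝓛(1PBDC(C_𝕄(k)))`: languages recognized with some matrix counter, of any
dimension, with `k` generators. -/
def matrixCounterClass (k : ℕ) : Set FiniteAlphabetLanguage :=
  {L | ∃ (m : ℕ) (C : GeneralizedCounter (Matrix.GeneralLinearGroup (Fin m) ℝ)),
    IsMatrixCounter k C ∧ L ∈ classOf C}

/-- The language `{aⁿ bⁿ cⁿ | n ∈ ℕ}` over the alphabet `a = 0`, `b = 1`, `c = 2`. -/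
def abcLanguage : FiniteAlphabetLanguage :=
  ⟨3, {w | ∃ n : ℕ, w = List.replicate n 0 ++ List.replicate n 1 ++ List.replicate n 2}⟩

/-- The language `{x # xᴿ | x ∈ Σ*}`, where `Σ` has `s` letters and the separator `#`, which is not
in `Σ`, is the last letter of the alphabet `Σ ∪ {#}`. -/
def palLanguage (s : ℕ) : FiniteAlphabetLanguage :=
  ⟨s + 1, {w | ∃ x : List (Fin s),
    w = x.map Fin.castSucc ++ [Fin.last s] ++ x.reverse.map Fin.castSucc}⟩

/-! The control is deterministic and never sees the counter. So the state and the scanned symbol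
alone fix how the counter has changed when the head leaves that symbol, however long the head rests
there. Hence a machine has finitely many possible factors per symbol (`finite_increments`), and
after a prefix of length `n` the counter is a product of `n + 1` of them, one for the left
end-marker. If two accepted words reach the same state and counter at their cuts, their tails can be
swapped; so a fooling set is no larger than the number of states times the number of such products
(`card_le_of_fooling`).

This gives both negative results. Over the integers, products of linear length take linearly many
values, while the words `aⁿbⁿcⁿ` have a fooling set of quadratic size. In any commutative group a
product depends only on the multiplicities of its factors, so there are polynomially many, against
exponentially many words `x` before `#`.

The inclusions come from injective homomorphisms that respect generators and negativity: `z ↦ z√p`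
embeds the integers in the reals, and `exp` embeds the reals in the `1 × 1` matrices, where size
below 1 means a negative exponent.

For the positive results, `√p` and `√q` are linearly independent over the integers, so one real
number holds two counters and compares the three letter counts. Two matrices generating a free
semigroup turn the counter into a stack: `x` is pushed and `xᴿ` popped. The identity is never an
operation, since it would lie in both `G*` and `Gᵢₙᵥ*`; therefore end-markers and separator carry
operations that cancel. -/

/-! ### Runs cut at a tape position, and the fooling set bound -/

instance {α : Type} [Finite α] : Finite (TapeSymbol α) := by
  refine Finite.of_injective (β := Option (Option α))
    (fun x => match x with
      | .leftEnd => none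
      | .rightEnd => some none
      | .letter a => some (some a)) ?_
  rintro (_ | a | _) (_ | b | _) h <;> simp_all

namespace OnePBDC

variable {U : Type} [Group U] {C : GeneralizedCounter U} {α Q : Type}

/-- Started in state `q` on the symbol `σ`, the finite control moves off `σ` in state `q'`, having
multiplied the counter by `X`. -/
inductive Scan (M : OnePBDC C α Q) (σ : TapeSymbol α) : Q → Q → U → Prop
  | right (q : Q) (h : (M.trans q σ).2.1 = HeadMove.right) :
      Scan M σ q (M.trans q σ).1 (M.trans q σ).2.2.val
  | stay (q q' : Q) (X : U) (h : (M.trans q σ).2.1 = HeadMove.stay)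
      (hs : Scan M σ (M.trans q σ).1 q' X) : Scan M σ q q' (X * (M.trans q σ).2.2.val)

/-- The transition depends on state and symbol only, so two scans agree step by step. Besides making
`increments` finite, this later forces every complete run of a constructed machine to have its
computed outcome. -/
theorem Scan.unique {M : OnePBDC C α Q} {σ : TapeSymbol α} {q q₁ q₂ : Q} {X₁ X₂ : U}
    (h₁ : M.Scan σ q q₁ X₁) (h₂ : M.Scan σ q q₂ X₂) : q₁ = q₂ ∧ X₁ = X₂ := by
  induction h₁ generalizing q₂ X₂ with
  | right q h =>
    cases h₂ with
    | right _ h' => exact ⟨rfl, rfl⟩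
    | stay _ _ X h' hs => rw [h] at h'; cases h'
  | stay q q' X h hs ih =>
    cases h₂ with
    | right _ h' => rw [h] at h'; cases h'
    | stay _ _ X h' hs' =>
      obtain ⟨rfl, rfl⟩ := ih hs'
      exact ⟨rfl, rfl⟩

/-- The possible effects on the counter of scanning one symbol. -/
def increments (M : OnePBDC C α Q) : Set U :=
  {X | ∃ σ q q', M.Scan σ q q' X}

theorem finite_increments [Finite α] [Finite Q] (M : OnePBDC C α Q) : M.increments.Finite := by
  classical
  let f : TapeSymbol α × Q → U := fun a =>
    -- The default 1 is taken only where the control never leaves the symbol.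
    if h : ∃ X, ∃ q', M.Scan a.1 a.2 q' X then h.choose else 1
  refine (Set.finite_range f).subset ?_
  rintro X ⟨σ, q, q', hX⟩
  have h : ∃ X, ∃ q', M.Scan σ q q' X := ⟨X, q', hX⟩
  refine ⟨(σ, q), ?_⟩
  obtain ⟨q'', h''⟩ := h.choose_spec
  simp only [f, dif_pos h]
  exact (h''.unique hX).2

/-- A run that leaves the tape passes the scanned symbol. -/
theorem exists_scan_of_run {M : OnePBDC C α Q} {σ : TapeSymbol α} {r : List (TapeSymbol α)}
    {q q' : Q} {Ω Ω' : U}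
    (h : Relation.ReflTransGen M.Step ⟨q, σ :: r, Ω⟩ ⟨q', [], Ω'⟩) :
    ∃ p X, M.Scan σ q p X ∧
      (∀ r', Relation.ReflTransGen M.Step ⟨q, σ :: r', Ω⟩ ⟨p, r', X * Ω⟩) ∧
      Relation.ReflTransGen M.Step ⟨p, r, X * Ω⟩ ⟨q', [], Ω'⟩ := by
  generalize hc : (⟨q, σ :: r, Ω⟩ : CounterConfig U α Q) = c at h
  induction h using Relation.ReflTransGen.head_induction_on generalizing q Ω with
  | refl => cases hc
  | head hstep hrun ih =>
    subst hc
    cases hstep with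
    | mk _ _ _ _ hΩ =>
      rcases hd : (M.trans q σ).2.1 with _ | _
      · rw [hd] at ih hrun
        obtain ⟨p, X, hs, hp, hf⟩ := ih rfl
        refine ⟨p, _, .stay q p X hd hs, fun r' => ?_, by simpa [mul_assoc] using hf⟩
        have := Step.mk (M := M) q σ r' Ω hΩ
        rw [hd] at this
        simpa [mul_assoc] using (hp r').head this
      · rw [hd] at hrun
        refine ⟨_, _, .right q hd, fun r' => ?_, hrun⟩
        have := Step.mk (M := M) q σ r' Ω hΩ
        rw [hd] at this
        exact .single this

/-- A run that leaves the tape passes every prefix of the tape. -/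
theorem exists_split_of_run {M : OnePBDC C α Q} {l r : List (TapeSymbol α)}
    {q q' : Q} {Ω Ω' : U}
    (h : Relation.ReflTransGen M.Step ⟨q, l ++ r, Ω⟩ ⟨q', [], Ω'⟩) :
    ∃ p, ∃ ys : List U, ys.length = l.length ∧ (∀ y ∈ ys, y ∈ M.increments) ∧
      (∀ r', Relation.ReflTransGen M.Step ⟨q, l ++ r', Ω⟩ ⟨p, r', ys.prod * Ω⟩) ∧
      Relation.ReflTransGen M.Step ⟨p, r, ys.prod * Ω⟩ ⟨q', [], Ω'⟩ := by
  induction l generalizing q Ω with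
  | nil => exact ⟨q, [], rfl, by simp, fun r' => by simpa using .refl, by simpa using h⟩
  | cons σ l ih =>
    obtain ⟨p, X, hs, hp, hf⟩ := exists_scan_of_run h
    obtain ⟨p', ys, hl, hy, hp', hf'⟩ := ih hf
    refine ⟨p', ys ++ [X], by simp [hl], ?_, fun r' => ?_, by simpa [mul_assoc] using hf'⟩
    · intro y hy'
      rcases List.mem_append.1 hy' with h' | h'
      · exact hy y h'
      · rw [List.mem_singleton.1 h']
        exact ⟨σ, q, p, hs⟩
    · simpa [mul_assoc] using (hp (l ++ r')).trans (hp' r')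

/-- A configuration `(p, X)` that is reached after the prefix `u`, and from which `v` is
accepted. -/
def Passes (M : OnePBDC C α Q) (u v : List α) (p : Q) (X : U) : Prop :=
  (∀ r, Relation.ReflTransGen M.Step
    ⟨M.start, TapeSymbol.leftEnd :: (u.map TapeSymbol.letter ++ r), 1⟩ ⟨p, r, X⟩) ∧
  ∃ q ∈ M.accepting, Relation.ReflTransGen M.Step
    ⟨p, v.map TapeSymbol.letter ++ [TapeSymbol.rightEnd], X⟩ ⟨q, [], 1⟩

theorem Passes.swap {M : OnePBDC C α Q} {u v u' v' : List α} {p : Q} {X : U}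
    (h : M.Passes u v p X) (h' : M.Passes u' v' p X) : u ++ v' ∈ M.language := by
  obtain ⟨q, hq, hr⟩ := h'.2
  refine ⟨q, hq, ?_⟩
  simpa [tape] using (h.1 _).trans hr

theorem exists_passes {M : OnePBDC C α Q} {u v : List α} (h : u ++ v ∈ M.language) :
    ∃ p, ∃ ys : List U, ys.length = u.length + 1 ∧ (∀ y ∈ ys, y ∈ M.increments) ∧
      M.Passes u v p ys.prod := by
  obtain ⟨q, hq, hr⟩ := h
  have : tape (u ++ v) = (TapeSymbol.leftEnd :: u.map TapeSymbol.letter) ++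
      (v.map TapeSymbol.letter ++ [TapeSymbol.rightEnd]) := by simp [tape]
  rw [this] at hr
  obtain ⟨p, ys, hl, hy, hp, hf⟩ := exists_split_of_run hr
  refine ⟨p, ys, by simpa using hl, hy, fun r => ?_, q, hq, by simpa using hf⟩
  simpa using hp r

/-- The fooling set argument: the configurations after the prefixes `u i` are pairwise distinct if
the words `u i ++ v j` with `i ≠ j` are rejected, so there are at least as many of them as there
are indices. -/
theorem card_le_of_fooling [Finite Q] (M : OnePBDC C α Q) {ι : Type} [Finite ι]
    (u v : ι → List α) (n : ℕ) (hu : ∀ i, (u i).length ≤ n)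
    (hmem : ∀ i, u i ++ v i ∈ M.language)
    (hne : ∀ i j, u i ++ v j ∈ M.language → i = j) (S : Set U) (hS : S.Finite)
    (hprod : ∀ ys : List U, ys.length ≤ n + 1 → (∀ y ∈ ys, y ∈ M.increments) → ys.prod ∈ S) :
    Nat.card ι ≤ Nat.card Q * S.ncard := by
  have : Finite S := hS
  choose p ys hl hy hP using fun i => exists_passes (hmem i)
  let f : ι → Q × S := fun i =>
    (p i, ⟨(ys i).prod, hprod _ (by rw [hl]; exact Nat.succ_le_succ (hu i)) (hy i)⟩)
  have hf : Function.Injective f := by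
    intro i j hij
    simp only [f, Prod.mk.injEq, Subtype.mk.injEq] at hij
    refine hne i j ((hP i).swap (?_ : M.Passes (u j) (v j) _ _))
    rw [hij.1, hij.2]
    exact hP j
  calc Nat.card ι ≤ Nat.card (Q × S) := Nat.card_le_card_of_injective f hf
    _ = _ := by rw [Nat.card_prod, Nat.card_coe_set_eq]

end OnePBDC

/-! ### The integer counter cannot recognize `aⁿbⁿcⁿ` -/

theorem Multiplicative.abs_toAdd_prod_le {ys : List (Multiplicative ℤ)} {B : ℕ}
    (h : ∀ y ∈ ys, |y.toAdd| ≤ B) : |ys.prod.toAdd| ≤ ys.length * B := by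
  induction ys with
  | nil => simp
  | cons y ys ih =>
    have h₁ := h y (by simp)
    have h₂ := ih fun z hz => h z (by simp [hz])
    rw [List.prod_cons, toAdd_mul, List.length_cons]
    push_cast
    linarith [abs_add_le y.toAdd ys.prod.toAdd]

theorem language_ne_abc {Q : Type} [Finite Q] (M : OnePBDC integerCounter (Fin 3) Q) :
    M.language ≠ {w | ∃ n : ℕ,
      w = List.replicate n 0 ++ List.replicate n 1 ++ List.replicate n 2} := by
  intro hM
  obtain ⟨B, hB⟩ : ∃ B : ℕ, ∀ y ∈ M.increments, |y.toAdd| ≤ (B : ℤ) := by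
    have : (Multiplicative.toAdd '' M.increments).Finite := M.finite_increments.image _
    obtain ⟨b, hb⟩ := (this.image (fun z : ℤ => z.natAbs)).bddAbove
    refine ⟨b, fun y hy => ?_⟩
    rw [Int.abs_eq_natAbs]
    exact_mod_cast hb ⟨_, ⟨y, hy, rfl⟩, rfl⟩
  -- The counter takes at most `2(3N+1)B + 1 ≤ (8B+1)N` values, so the fooling bound reads `N² ≤
  -- |Q|(8B+1)N`, which fails for this `N`.
  set N : ℕ := Nat.card Q * (8 * B + 1) + 1 with hN
  -- The cut lies inside the block of `b`s. Two parameters, the numbers of `b`s on either side, give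
  -- `N²` words of linear length; a single parameter would not beat the linear range of the counter.
  let u : Fin N × Fin N → List (Fin 3) := fun i =>
    List.replicate (i.1 + i.2) 0 ++ List.replicate i.2 1
  let v : Fin N × Fin N → List (Fin 3) := fun i =>
    List.replicate i.1 1 ++ List.replicate (i.1 + i.2) 2
  let S : Set (Multiplicative ℤ) :=
    Multiplicative.toAdd ⁻¹' Set.Icc (-((3 * N + 1) * B : ℕ) : ℤ) ((3 * N + 1) * B : ℕ)
  have hS : S.Finite := (Set.finite_Icc _ _).preimage Multiplicative.toAdd.injective.injOn
  have hcard : S.ncard = 2 * ((3 * N + 1) * B) + 1 := by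
    have : S.ncard = (Set.Icc (-((3 * N + 1) * B : ℕ) : ℤ) ((3 * N + 1) * B : ℕ)).ncard :=
      Set.ncard_preimage_of_injective_subset_range Multiplicative.toAdd.injective
        (by simp [Multiplicative.toAdd.surjective.range_eq])
    rw [this, ← Finset.coe_Icc, Set.ncard_coe_finset, Int.card_Icc]
    omega
  have key := M.card_le_of_fooling u v (3 * N) ?_ ?_ ?_ S hS ?_
  · rw [hcard, Nat.card_prod, Nat.card_fin] at key
    have h₁ : 2 * ((3 * N + 1) * B) + 1 ≤ (8 * B + 1) * N := by nlinarith
    have h₂ := key.trans (Nat.mul_le_mul_left _ h₁)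
    rw [← mul_assoc] at h₂
    have := Nat.le_of_mul_le_mul_right h₂ (by omega)
    omega
  · intro i
    have h₁ := i.1.isLt
    have h₂ := i.2.isLt
    have : (u i).length = i.1 + i.2 + i.2 := by simp [u]
    omega
  · intro i
    rw [hM]
    refine ⟨i.1 + i.2, ?_⟩
    simp only [u, v, List.append_assoc]
    rw [← List.append_assoc (List.replicate (i.2 : ℕ) 1), List.replicate_append_replicate,
      add_comm (i.2 : ℕ)]
  · intro i j h
    rw [hM] at h
    obtain ⟨n, hn⟩ := h
    have h₀ := congrArg (List.count (0 : Fin 3)) hn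
    have h₁ := congrArg (List.count (1 : Fin 3)) hn
    have h₂ := congrArg (List.count (2 : Fin 3)) hn
    simp [u, v, List.count_replicate] at h₀ h₁ h₂
    ext <;> omega
  · intro ys hl hy
    have := Multiplicative.abs_toAdd_prod_le fun y h => hB y (hy y h)
    have h' : (ys.length * B : ℤ) ≤ ((3 * N + 1) * B : ℕ) := by
      exact_mod_cast Nat.mul_le_mul_right B hl
    exact abs_le.1 (this.trans h')

theorem abcLanguage_notMem_integerCounterClass : abcLanguage ∉ integerCounterClass := by
  rintro ⟨Q, _, M, hM⟩
  exact language_ne_abc M hM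

/-! ### Commutative counters cannot recognize palindromes -/

/-- In a commutative monoid there are polynomially many products of length at most `n`. -/
theorem finite_prod_of_length_le {U : Type} [CommMonoid U] {F : Set U} (hF : F.Finite) (n : ℕ) :
    ∃ S : Set U, S.Finite ∧ S.ncard ≤ (n + 1) ^ F.ncard ∧
      ∀ ys : List U, ys.length ≤ n → (∀ y ∈ ys, y ∈ F) → ys.prod ∈ S := by
  classical
  have : Fintype F := hF.fintype
  -- A product is determined by how often each element of `F` occurs, and each multiplicity is at
  -- most `n`.
  let f : (F → Fin (n + 1)) → U := fun c => ∏ x : F, (x : U) ^ (c x : ℕ)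
  refine ⟨Set.range f, Set.finite_range f, ?_, fun ys hl hy => ?_⟩
  · rw [← Nat.card_coe_set_eq]
    refine (Finite.card_range_le f).trans ?_
    simp
  · refine ⟨fun x => ⟨ys.count (x : U), Nat.lt_succ_of_le (List.count_le_length.trans hl)⟩, ?_⟩
    simp only [f]
    rw [Finset.prod_list_count_of_subset ys F.toFinset
      (fun y h => by simpa using hy y (by simpa using h)),
      Finset.prod_set_coe F (f := fun x => x ^ ys.count x)]

/-- The base is `n + 2` because a prefix of length `n` yields products of length at most `n + 1`,
with multiplicities from 0 to `n + 1`. The factor 4 in the proof absorbs the shift by 2 in the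
exponent of 2. -/
theorem exists_mul_pow_lt_two_pow (c d : ℕ) : ∃ n : ℕ, c * (n + 2) ^ d < 2 ^ n := by
  have h := (tendsto_pow_const_div_const_pow_of_one_lt d (one_lt_two (α := ℝ))).comp
    (Filter.tendsto_add_atTop_nat 2)
  have hc : (0 : ℝ) < 1 / (4 * (c + 1)) := by positivity
  obtain ⟨n, hn⟩ := (h.eventually_lt_const hc).exists
  refine ⟨n, ?_⟩
  simp only [Function.comp_apply] at hn
  rw [div_lt_div_iff₀ (by positivity) (by positivity), pow_add (2 : ℝ)] at hn
  have h₀ : (0 : ℝ) ≤ ((n + 2 : ℕ) : ℝ) ^ d := by positivity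
  have : (c : ℝ) * ((n + 2 : ℕ) : ℝ) ^ d < 2 ^ n := by nlinarith
  exact_mod_cast this

theorem language_ne_pal {U : Type} [CommGroup U] {C : GeneralizedCounter U} {s : ℕ} (hs : 2 ≤ s)
    {Q : Type} [Finite Q] (M : OnePBDC C (Fin (s + 1)) Q) :
    M.language ≠ {w | ∃ x : List (Fin s),
      w = x.map Fin.castSucc ++ [Fin.last s] ++ x.reverse.map Fin.castSucc} := by
  intro hM
  obtain ⟨n, hn⟩ := exists_mul_pow_lt_two_pow (Nat.card Q) M.increments.ncard
  obtain ⟨S, hS, hcard, hprod⟩ := finite_prod_of_length_le M.finite_increments (n + 1)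
  have key := M.card_le_of_fooling (ι := Fin n → Fin s)
    (fun x => (List.ofFn x).map Fin.castSucc)
    (fun x => [Fin.last s] ++ (List.ofFn x).reverse.map Fin.castSucc) n (by simp) ?_ ?_ S hS hprod
  · refine absurd (key.trans (Nat.mul_le_mul_left _ hcard)) (not_le.2 (hn.trans_le ?_))
    simpa using Nat.pow_le_pow_left hs n
  · intro x
    rw [hM]
    exact ⟨List.ofFn x, by simp only [List.append_assoc]⟩
  · intro x y h
    rw [hM] at h
    obtain ⟨z, hz⟩ := h
    rw [List.append_assoc] at hz
    -- Comparing lengths gives `|z| = n`, so the two factorizations split at the same place and `z`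
    -- equals both `x` and `y`.
    have hl := congrArg List.length hz
    simp at hl
    obtain ⟨h₁, h₂⟩ := List.append_inj hz (by simp; omega)
    have h₃ := (List.append_inj h₂ (by simp)).2
    rw [List.map_inj_right (Fin.castSucc_injective s)] at h₁ h₃
    rw [List.reverse_inj] at h₃
    exact List.ofFn_injective (h₁.trans h₃.symm)

theorem palLanguage_notMem_classOf {U : Type} [CommGroup U] (C : GeneralizedCounter U) {s : ℕ}
    (hs : 2 ≤ s) : palLanguage s ∉ classOf C := by
  rintro ⟨Q, _, M, hM⟩
  exact language_ne_pal hs M hM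

/-! ### Embeddings of counters and the two inclusions -/

/-- The embedding of counters: if an injective homomorphism maps operations to operations and
preserves and reflects negativity, then machines can be transported along it. -/
theorem classOf_subset_of_embedding {U V : Type} [Group U] [Group V] {C : GeneralizedCounter U}
    {D : GeneralizedCounter V} (φ : U →* V) (hφ : Function.Injective φ)
    (hgen : ∀ x ∈ C.gen, φ x ∈ D.gen) (hneg : ∀ x, φ x ∈ D.neg ↔ x ∈ C.neg) :
    classOf C ⊆ classOf D := by
  rintro ⟨n, L⟩ ⟨Q, hQ, M, hM⟩
  let e : C.Operation → D.Operation := fun X =>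
    ⟨φ X.val, X.2.imp (hgen _) fun h => by simpa using hgen _ h⟩
  let M' : OnePBDC D (Fin n) Q :=
    ⟨M.start, M.accepting, fun q σ =>
      ((M.trans q σ).1, (M.trans q σ).2.1, e (M.trans q σ).2.2)⟩
  refine ⟨Q, hQ, M', ?_⟩
  let g : CounterConfig U (Fin n) Q → CounterConfig V (Fin n) Q :=
    fun c => ⟨c.state, c.rest, φ c.counter⟩
  have hstep : ∀ c c', M.Step c c' → M'.Step (g c) (g c') := by
    rintro _ _ ⟨q, σ, τ, Ω, hΩ⟩
    have := OnePBDC.Step.mk (M := M') q σ τ (φ Ω) (by rwa [hneg])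
    simpa [g, M', e] using this
  have hstep' : ∀ c d, M'.Step (g c) d → ∃ c', M.Step c c' ∧ d = g c' := by
    rintro ⟨q, l, Ω⟩ d h
    cases h with
    | mk _ σ τ _ hΩ =>
      exact ⟨_, .mk q σ τ Ω (by rwa [hneg] at hΩ), by simp [g, M', e]⟩
  rw [← hM]
  ext w
  constructor
  · rintro ⟨q, hq, h⟩
    -- Everything reachable from an image is an image, so a run of `M'` pulls back to `M`;
    -- injectivity then brings the final identity back.
    have key : ∀ d, Relation.ReflTransGen M'.Step (g ⟨M.start, OnePBDC.tape w, 1⟩) d →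
        ∃ c, Relation.ReflTransGen M.Step ⟨M.start, OnePBDC.tape w, 1⟩ c ∧ d = g c := by
      intro d hd
      induction hd with
      | refl => exact ⟨_, .refl, rfl⟩
      | tail _ hs ih =>
        obtain ⟨c, hc, rfl⟩ := ih
        obtain ⟨c', hc', rfl⟩ := hstep' _ _ hs
        exact ⟨c', hc.tail hc', rfl⟩
    obtain ⟨⟨q', l, Ω⟩, hc, hc'⟩ := key ⟨q, [], 1⟩ (by simpa [g] using h)
    simp only [g, CounterConfig.mk.injEq] at hc'
    obtain ⟨rfl, rfl, h₁⟩ := hc'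
    rw [eq_comm, map_eq_one_iff φ hφ] at h₁
    subst h₁
    exact ⟨q, hq, hc⟩
  · rintro ⟨q, hq, h⟩
    refine ⟨q, hq, ?_⟩
    have : ∀ d, Relation.ReflTransGen M.Step ⟨M.start, OnePBDC.tape w, 1⟩ d →
        Relation.ReflTransGen M'.Step (g ⟨M.start, OnePBDC.tape w, 1⟩) (g d) := by
      intro d hd
      induction hd with
      | refl => exact .refl
      | tail _ hs ih => exact ih.tail (hstep _ _ hs)
    simpa [g] using this _ h

theorem integerCounterClass_subset_classOf_realCounter {P : Finset ℕ} (hP : ∀ p ∈ P, p.Prime)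
    (hne : P.Nonempty) : integerCounterClass ⊆ classOf (realCounter P hP) := by
  obtain ⟨p, hp⟩ := hne
  have hpos : (0 : ℝ) < √p := Real.sqrt_pos.2 (Nat.cast_pos.2 (hP p hp).pos)
  let f : ℤ →+ ℝ := (AddMonoidHom.mulRight √p).comp (Int.castAddHom ℝ)
  have hf : ∀ z, f z = z * √p := fun z => rfl
  refine classOf_subset_of_embedding f.toMultiplicative ?_ ?_ ?_
  · intro x y h
    have : f x.toAdd = f y.toAdd := h
    rw [hf, hf, mul_left_inj' hpos.ne', Int.cast_inj] at this
    exact Multiplicative.toAdd.injective this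
  · intro x hx
    rw [Finset.mem_singleton.1 hx]
    refine Finset.mem_image.2 ⟨p, hp, ?_⟩
    change Multiplicative.ofAdd √p = Multiplicative.ofAdd (f 1)
    rw [hf, Int.cast_one, one_mul]
  · intro x
    change f x.toAdd < 0 ↔ x.toAdd < 0
    rw [hf, ← Int.cast_lt_zero (R := ℝ)]
    constructor
    · intro h
      exact neg_of_mul_neg_left h hpos.le
    · intro h
      exact mul_neg_of_neg_of_pos h hpos

/-- The image of a counter under an injective homomorphism. -/
def GeneralizedCounter.map {U V : Type} [Group U] [Group V] (C : GeneralizedCounter U)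
    (φ : U →* V) (hφ : Function.Injective φ) (N : Set V) (hN : ∀ x, φ x ∈ N ↔ x ∈ C.neg) :
    GeneralizedCounter V :=
  have hpos : (Subsemigroup.closure (C.gen.map ⟨φ, hφ⟩ : Set V) : Set V) =
      φ '' Subsemigroup.closure (C.gen : Set U) := by
    rw [Finset.coe_map]
    exact congrArg SetLike.coe (MulHom.map_mclosure (φ : U →ₙ* V) _).symm
  have hinv : (Subsemigroup.closure {X : V | X⁻¹ ∈ C.gen.map ⟨φ, hφ⟩} : Set V) =
      φ '' Subsemigroup.closure {X : U | X⁻¹ ∈ C.gen} := by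
    have : {X : V | X⁻¹ ∈ C.gen.map ⟨φ, hφ⟩} = φ '' {X : U | X⁻¹ ∈ C.gen} := by
      ext X
      simp only [Finset.mem_map, Function.Embedding.coeFn_mk, Set.mem_ofPred_eq, Set.mem_image]
      constructor
      · rintro ⟨y, hy, h⟩
        exact ⟨y⁻¹, by simpa using hy, by rw [map_inv, h, inv_inv]⟩
      · rintro ⟨y, hy, rfl⟩
        exact ⟨y⁻¹, hy, map_inv φ y⟩
    rw [this]
    exact congrArg SetLike.coe (MulHom.map_mclosure (φ : U →ₙ* V) _).symm
  { gen := C.gen.map ⟨φ, hφ⟩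
    neg := N
    closure_disjoint := by
      rw [hpos, hinv]
      exact (Set.disjoint_image_iff hφ).2 C.closure_disjoint
    neg_disjoint := by
      rw [hpos, Set.disjoint_left]
      rintro _ hx ⟨y, hy, rfl⟩
      exact Set.disjoint_left.1 C.neg_disjoint ((hN y).1 hx) hy
    inv_closure_subset := by
      rw [hinv]
      rintro _ ⟨y, hy, rfl⟩
      exact (hN y).2 (C.inv_closure_subset hy) }

theorem classOf_subset_classOf_map {U V : Type} [Group U] [Group V] (C : GeneralizedCounter U)
    (φ : U →* V) (hφ : Function.Injective φ) (N : Set V) (hN : ∀ x, φ x ∈ N ↔ x ∈ C.neg) :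
    classOf C ⊆ classOf (C.map φ hφ N hN) :=
  classOf_subset_of_embedding φ hφ (fun _ hx => Finset.mem_map_of_mem _ hx) hN

/-- The exponential function as a homomorphism to the invertible `1 × 1` matrices. -/
noncomputable def expMatrixHom : Multiplicative ℝ →* Matrix.GeneralLinearGroup (Fin 1) ℝ :=
  MonoidHom.toHomUnits
    (((Matrix.scalar (Fin 1) : ℝ →+* Matrix (Fin 1) (Fin 1) ℝ) : ℝ →* _).comp Real.expMonoidHom)

theorem expMatrixHom_apply (x : Multiplicative ℝ) :
    (expMatrixHom x).val 0 0 = Real.exp x.toAdd := by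
  simp [expMatrixHom]

theorem expMatrixHom_injective : Function.Injective expMatrixHom := by
  intro x y h
  have := congrArg (fun X => X.val 0 0) h
  simp only [expMatrixHom_apply] at this
  exact Multiplicative.toAdd.injective (Real.exp_injective this)

theorem matrixSize_expMatrixHom (x : Multiplicative ℝ) :
    matrixSize (expMatrixHom x) = Real.exp x.toAdd := by
  simp [matrixSize, expMatrixHom_apply, Real.sqrt_sq (Real.exp_pos _).le]

theorem card_gen_realCounter (P : Finset ℕ) (hP : ∀ p ∈ P, p.Prime) :
    (realCounter P hP).gen.card = P.card := by
  refine Finset.card_image_of_injective P fun p q h => ?_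
  have : √(p : ℝ) = √(q : ℝ) := h
  rwa [Real.sqrt_inj (Nat.cast_nonneg p) (Nat.cast_nonneg q), Nat.cast_inj] at this

/-- The size of a positive `1 × 1` matrix is its entry, and `exp x < 1` exactly when `x < 0`.
Injectivity of `exp` and of the square root keeps the number of generators equal to `k`. -/
theorem realCounterClass_subset_matrixCounterClass (k : ℕ) :
    realCounterClass k ⊆ matrixCounterClass k := by
  rintro L ⟨P, hP, hk, hL⟩
  have hN : ∀ x, expMatrixHom x ∈ {X | matrixSize X < 1} ↔ x ∈ (realCounter P hP).neg := by
    intro x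
    rw [Set.mem_ofPred_eq, matrixSize_expMatrixHom, Real.exp_lt_one_iff]
    rfl
  refine ⟨1, (realCounter P hP).map expMatrixHom expMatrixHom_injective _ hN, ⟨?_, rfl⟩,
    classOf_subset_classOf_map _ _ _ _ hN hL⟩
  exact (Finset.card_map _).trans ((card_gen_realCounter P hP).trans hk)

/-! ### Machines that perform a block of operations on each symbol -/

namespace GeneralizedCounter

variable {U : Type} [Group U] {C : GeneralizedCounter U}

/-- The increment by a generator. -/
def Operation.push (x : U) (hx : x ∈ C.gen) : C.Operation := ⟨x, .inl hx⟩

/-- The decrement by a generator. -/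
def Operation.pop (x : U) (hx : x ∈ C.gen) : C.Operation := ⟨x⁻¹, .inr (by simpa using hx)⟩

/-- The total effect of a sequence of operations. -/
def effect : List C.Operation → U
  | [] => 1
  | o :: l => effect l * o.val

/-- No operation of the sequence is performed on a negative counter. -/
def Safe : List C.Operation → U → Prop
  | [], _ => True
  | o :: l, Ω => Ω ∉ C.neg ∧ Safe l (o.val * Ω)

end GeneralizedCounter

open GeneralizedCounter

/-- The control of a machine that always moves to the right, and performs a block of operations
on each symbol. -/
structure BlockControl {U : Type} [Group U] (C : GeneralizedCounter U) (α Q : Type) where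
  next : Q → TapeSymbol α → Q
  block : Q → TapeSymbol α → C.Operation × List C.Operation

namespace BlockControl

variable {U : Type} [Group U] {C : GeneralizedCounter U} {α Q : Type}

/-- The operations performed on a symbol. -/
def ops (B : BlockControl C α Q) (q : Q) (σ : TapeSymbol α) : List C.Operation :=
  (B.block q σ).1 :: (B.block q σ).2

/-- The machine with blocks of at most `N + 1` operations. -/
def toMachine (B : BlockControl C α Q) (N : ℕ) (start : Q) (acc : Set Q) :
    OnePBDC C α (Q × Fin (N + 1)) where
  start := (start, 0)
  accepting := {s | s.1 ∈ acc}
  trans s σ :=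
    -- The second component is the index of the next operation. If blocks have at most `N + 1`
    -- operations, the first condition follows from the second, and the default of `getD` is never
    -- used on a scan begun at index 0.
    if h : s.2 < N ∧ s.2 + 1 < (B.ops s.1 σ).length then
      ((s.1, ⟨s.2 + 1, Nat.succ_lt_succ h.1⟩), .stay,
        (B.ops s.1 σ)[(s.2 : ℕ)]?.getD (B.block s.1 σ).1)
    else ((B.next s.1 σ, 0), .right, (B.ops s.1 σ)[(s.2 : ℕ)]?.getD (B.block s.1 σ).1)

/-- The final state and the total effect on the counter of the blocks on a tape. -/
def outcome (B : BlockControl C α Q) : Q → List (TapeSymbol α) → Q × U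
  | q, [] => (q, 1)
  | q, σ :: τ =>
    ((B.outcome (B.next q σ) τ).1, (B.outcome (B.next q σ) τ).2 * effect (B.ops q σ))

variable {B : BlockControl C α Q} {N : ℕ} {start : Q} {acc : Set Q}

/-- Induction on the operations still to be done. The scan needs no safety and serves to show that
accepted words are in the language; the run needs `Safe` and serves the converse. -/
theorem scan_of_drop (hN : ∀ q σ, (B.ops q σ).length ≤ N + 1) (q : Q) (σ : TapeSymbol α)
    (l : List C.Operation) (o : C.Operation) (j : Fin (N + 1))
    (h : (B.ops q σ).drop j = o :: l) :
    (B.toMachine N start acc).Scan σ (q, j) (B.next q σ, 0) (effect (o :: l)) ∧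
      ∀ (τ : List (TapeSymbol α)) (Ω : U), Safe (o :: l) Ω →
        Relation.ReflTransGen (B.toMachine N start acc).Step ⟨(q, j), σ :: τ, Ω⟩
          ⟨(B.next q σ, 0), τ, effect (o :: l) * Ω⟩ := by
  have hlen := congrArg List.length h
  rw [List.length_drop, List.length_cons] at hlen
  have hget : (B.ops q σ)[(j : ℕ)]? = some o := by
    have := congrArg (fun l => l[0]?) h
    simpa using this
  have hb := hN q σ
  induction l generalizing o j with
  | nil =>
    rw [List.length_nil] at hlen
    have ht : (B.toMachine N start acc).trans (q, j) σ = ((B.next q σ, 0), .right, o) := by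
      simp only [toMachine]
      rw [dif_neg (by omega), hget]
      rfl
    constructor
    · have := OnePBDC.Scan.right (M := B.toMachine N start acc) (σ := σ) (q, j) (by rw [ht])
      rw [ht] at this
      simpa [effect] using this
    · intro τ Ω hs
      have := OnePBDC.Step.mk (M := B.toMachine N start acc) (q, j) σ τ Ω hs.1
      rw [ht] at this
      simpa [effect, HeadMove.apply] using Relation.ReflTransGen.single this
  | cons o' l ih =>
    rw [List.length_cons] at hlen
    have hj : (j : ℕ) < N := by omega
    have ht : (B.toMachine N start acc).trans (q, j) σ =
        ((q, ⟨j + 1, Nat.succ_lt_succ hj⟩), .stay, o) := by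
      simp only [toMachine]
      rw [dif_pos ⟨hj, by omega⟩, hget]
      rfl
    have hd : (B.ops q σ).drop (j + 1) = o' :: l := by
      rw [← List.drop_drop, h]
      rfl
    obtain ⟨h₁, h₂⟩ := ih o' ⟨j + 1, Nat.succ_lt_succ hj⟩ hd
      (by rw [← List.length_drop, hd, List.length_cons])
      (by have := congrArg (fun l => l[0]?) hd
          simpa using this)
    constructor
    · have := OnePBDC.Scan.stay (M := B.toMachine N start acc) (σ := σ) (q, j) _ _
        (by rw [ht]) (by rw [ht]; exact h₁)
      rw [ht] at this
      exact this
    · intro τ Ω hs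
      have := OnePBDC.Step.mk (M := B.toMachine N start acc) (q, j) σ τ Ω hs.1
      rw [ht] at this
      have hr := (h₂ τ _ hs.2).head this
      rwa [← mul_assoc] at hr

theorem run_block (hN : ∀ q σ, (B.ops q σ).length ≤ N + 1) (q : Q) (σ : TapeSymbol α)
    (τ : List (TapeSymbol α)) (Ω : U) (hs : Safe (B.ops q σ) Ω) :
    Relation.ReflTransGen (B.toMachine N start acc).Step ⟨(q, 0), σ :: τ, Ω⟩
      ⟨(B.next q σ, 0), τ, effect (B.ops q σ) * Ω⟩ :=
  (scan_of_drop hN q σ _ _ 0 rfl).2 τ Ω hs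

/-- Crashes can only destroy runs, so `Scan.unique` pins down any complete run without a safety
hypothesis. -/
theorem eq_outcome_of_run (hN : ∀ q σ, (B.ops q σ).length ≤ N + 1) {q : Q}
    {l : List (TapeSymbol α)} {Ω Ω' : U} {s : Q × Fin (N + 1)}
    (h : Relation.ReflTransGen (B.toMachine N start acc).Step ⟨(q, 0), l, Ω⟩ ⟨s, [], Ω'⟩) :
    s.1 = (B.outcome q l).1 ∧ Ω' = (B.outcome q l).2 * Ω := by
  induction l generalizing q Ω with
  | nil =>
    rcases Relation.ReflTransGen.cases_head h with h | ⟨c, hc, -⟩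
    · simp only [CounterConfig.mk.injEq, true_and] at h
      obtain ⟨rfl, rfl⟩ := h
      simp [outcome]
    · cases hc
  | cons σ τ ih =>
    obtain ⟨p, X, hs, -, hr⟩ := OnePBDC.exists_scan_of_run h
    obtain ⟨rfl, rfl⟩ := hs.unique (scan_of_drop hN q σ _ _ 0 rfl).1
    obtain ⟨h₁, h₂⟩ := ih hr
    exact ⟨h₁, by rw [h₂, outcome, mul_assoc]; rfl⟩

theorem outcome_of_accepts (hN : ∀ q σ, (B.ops q σ).length ≤ N + 1) {w : List α}
    (h : (B.toMachine N start acc).Accepts w) :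
    (B.outcome start (OnePBDC.tape w)).1 ∈ acc ∧ (B.outcome start (OnePBDC.tape w)).2 = 1 := by
  obtain ⟨s, hs, hr⟩ := h
  obtain ⟨h₁, h₂⟩ := eq_outcome_of_run hN hr
  refine ⟨h₁ ▸ hs, ?_⟩
  rw [mul_one] at h₂
  exact h₂.symm

end BlockControl

/-! ### Recognizing `aⁿbⁿcⁿ` with two square roots -/

/-- If `y ≠ 0`, multiplying the relation by `√p` makes `√(pq)` rational. But `pq` is not a square:
`p` would divide the root, hence also `q`. -/
theorem int_combination_sqrt_primes {p q : ℕ} (hp : p.Prime) (hq : q.Prime) (hpq : p ≠ q)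
    {x y : ℤ} (h : x * √p + y * √q = 0) : x = 0 ∧ y = 0 := by
  have hirr : Irrational √((p * q : ℕ) : ℝ) := by
    rw [irrational_sqrt_natCast_iff]
    rintro ⟨r, hr⟩
    have h₁ : p ∣ r := by
      have : p ∣ r * r := hr ▸ dvd_mul_right p q
      exact (hp.dvd_mul.1 this).elim id id
    have h₂ : p ∣ q := by
      obtain ⟨t, rfl⟩ := h₁
      refine ⟨t * t, Nat.eq_of_mul_eq_mul_left hp.pos ?_⟩
      rw [hr]
      ring
    exact hpq ((Nat.prime_dvd_prime_iff_eq hp hq).1 h₂)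
  have hp₀ : (0 : ℝ) < √p := Real.sqrt_pos.2 (Nat.cast_pos.2 hp.pos)
  have hpp : √(p : ℝ) * √p = p := Real.mul_self_sqrt (Nat.cast_nonneg p)
  have hy : y = 0 := by
    by_contra hy
    have : √((p * q : ℕ) : ℝ) = ((-(x * p) / y : ℚ) : ℝ) := by
      have hy' : (y : ℝ) ≠ 0 := Int.cast_ne_zero.2 hy
      push_cast
      rw [Real.sqrt_mul (Nat.cast_nonneg p), eq_div_iff hy']
      linear_combination √(p : ℝ) * h - x * hpp
    exact hirr ⟨_, this.symm⟩
  subst hy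
  simp only [Int.cast_zero, zero_mul, add_zero, mul_eq_zero, Int.cast_eq_zero, hp₀.ne',
    or_false] at h
  exact ⟨h, rfl⟩

section

variable {P : Finset ℕ} {hP : ∀ p ∈ P, p.Prime} {p q : ℕ}

theorem ofAdd_sqrt_mem_gen (hp : p ∈ P) : Multiplicative.ofAdd √p ∈ (realCounter P hP).gen :=
  Finset.mem_image_of_mem _ hp

/-- The control for `aⁿ bⁿ cⁿ`: the state `i` allows the letters from `i` on. -/
noncomputable def abcControl (hp : p ∈ P) (hq : q ∈ P) :
    BlockControl (realCounter P hP) (Fin 3) (Fin 3 ⊕ Bool) where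
  next
    | .inl i, .leftEnd => .inl i
    | .inl i, .letter a => if i ≤ a then .inl a else .inr false
    | .inl _, .rightEnd => .inr true
    | .inr _, _ => .inr false
  block
    -- Every step changes the counter, so the left end-marker adds `√p` and the right one removes
    -- it. The multiple of `√p` otherwise compares `a`s with `b`s, that of `√q` compares `a`s with
    -- `c`s.
    | _, .leftEnd => (.push _ (ofAdd_sqrt_mem_gen hp), [])
    | _, .letter 0 => (.push _ (ofAdd_sqrt_mem_gen hp), [.push _ (ofAdd_sqrt_mem_gen hq)])
    | _, .letter 1 => (.pop _ (ofAdd_sqrt_mem_gen hp), [])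
    | _, .letter 2 => (.pop _ (ofAdd_sqrt_mem_gen hq), [])
    | _, .rightEnd => (.pop _ (ofAdd_sqrt_mem_gen hp), [])

variable {hp : p ∈ P} {hq : q ∈ P}

theorem abcControl_length (s : Fin 3 ⊕ Bool) (σ : TapeSymbol (Fin 3)) :
    ((abcControl (hP := hP) hp hq).ops s σ).length ≤ 1 + 1 := by
  rcases σ with _ | a | _
  · simp [abcControl, BlockControl.ops]
  · fin_cases a <;> simp [abcControl, BlockControl.ops]
  · simp [abcControl, BlockControl.ops]

/-- The change of the counter on a letter. -/
noncomputable def abcChange (p q : ℕ) : Fin 3 → ℝ := ![√p + √q, -√p, -√q]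

theorem toAdd_effect_abcControl (s : Fin 3 ⊕ Bool) (a : Fin 3) :
    (effect ((abcControl (hP := hP) hp hq).ops s (.letter a))).toAdd = abcChange p q a := by
  fin_cases a <;>
    simp [abcControl, BlockControl.ops, effect, abcChange, Operation.push, Operation.pop, add_comm]

/-- Negativity is tested before each operation, and the only block of two operations consists of
increments; so the content at the start of the block decides. -/
theorem safe_abcControl (s : Fin 3 ⊕ Bool) (σ : TapeSymbol (Fin 3)) (Ω : Multiplicative ℝ)
    (hΩ : 0 ≤ Ω.toAdd) : Safe ((abcControl (hP := hP) hp hq).ops s σ) Ω := by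
  have h : ∀ x : Multiplicative ℝ, 0 ≤ x.toAdd → x ∉ (realCounter P hP).neg := fun x hx =>
    not_lt.2 hx
  rcases σ with _ | a | _
  · exact ⟨h _ hΩ, trivial⟩
  · fin_cases a
    · exact ⟨h _ hΩ, h _ (add_nonneg (Real.sqrt_nonneg _) hΩ), trivial⟩
    · exact ⟨h _ hΩ, trivial⟩
    · exact ⟨h _ hΩ, trivial⟩
  · exact ⟨h _ hΩ, trivial⟩

theorem outcome_abcControl_dead (b : Bool) (σ : TapeSymbol (Fin 3))
    (l : List (TapeSymbol (Fin 3))) :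
    ((abcControl (hP := hP) hp hq).outcome (.inr b) (σ :: l)).1 = .inr false := by
  induction l generalizing b σ with
  | nil => simp [BlockControl.outcome, abcControl]
  | cons τ l ih =>
    rw [BlockControl.outcome]
    exact ih false τ

theorem outcome_abcControl (w : List (Fin 3)) (i : Fin 3)
    (h : ((abcControl (hP := hP) hp hq).outcome (.inl i)
      (w.map TapeSymbol.letter ++ [TapeSymbol.rightEnd])).1 = .inr true) :
    (∀ a ∈ w, i ≤ a) ∧ w.Pairwise (· ≤ ·) ∧
    ((abcControl (hP := hP) hp hq).outcome (.inl i)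
      (w.map TapeSymbol.letter ++ [TapeSymbol.rightEnd])).2.toAdd =
      (w.map (abcChange p q)).sum - √p := by
  induction w generalizing i with
  | nil =>
    simp [BlockControl.outcome, abcControl, BlockControl.ops, effect, Operation.pop]
  | cons a w ih =>
    rw [List.map_cons, List.cons_append, BlockControl.outcome] at h ⊢
    by_cases hia : i ≤ a
    · have hn : (abcControl (hP := hP) hp hq).next (.inl i) (.letter a) = .inl a := by
        simp [abcControl, hia]
      rw [hn] at h ⊢
      obtain ⟨h₁, h₂, h₃⟩ := ih a h
      refine ⟨?_, List.pairwise_cons.2 ⟨h₁, h₂⟩, ?_⟩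
      · intro b hb
        rcases List.mem_cons.1 hb with rfl | hb
        · exact hia
        · exact hia.trans (h₁ b hb)
      · rw [toAdd_mul, h₃, toAdd_effect_abcControl, List.map_cons, List.sum_cons]
        ring
    · have hn : (abcControl (hP := hP) hp hq).next (.inl i) (.letter a) = .inr false := by
        simp [abcControl, hia]
      rw [hn] at h
      rcases w with _ | ⟨b, w⟩
      · rw [List.map_nil, List.nil_append, outcome_abcControl_dead] at h
        simp at h
      · rw [List.map_cons, List.cons_append, outcome_abcControl_dead] at h
        simp at h

theorem sum_map_abcChange (w : List (Fin 3)) : (w.map (abcChange p q)).sum =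
    ((w.count 0 : ℤ) - w.count 1 : ℤ) * √p + ((w.count 0 : ℤ) - w.count 2 : ℤ) * √q := by
  induction w with
  | nil => simp
  | cons a w ih =>
    rw [List.map_cons, List.sum_cons, ih]
    fin_cases a <;> simp [abcChange] <;> ring

theorem eq_replicate_of_pairwise {w : List (Fin 3)} (hw : w.Pairwise (· ≤ ·)) {n : ℕ}
    (h₀ : w.count 0 = n) (h₁ : w.count 1 = n) (h₂ : w.count 2 = n) :
    w = List.replicate n 0 ++ List.replicate n 1 ++ List.replicate n 2 := by
  refine List.Perm.eq_of_pairwise' (r := (· ≤ ·)) hw ?_ ?_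
  · simp only [List.pairwise_append, List.pairwise_replicate, List.mem_append,
      List.mem_replicate]
    refine ⟨⟨by simp, by simp, ?_⟩, by simp, ?_⟩
    · rintro a ⟨-, rfl⟩ b ⟨-, rfl⟩
      decide
    · rintro a (⟨-, rfl⟩ | ⟨-, rfl⟩) b ⟨-, rfl⟩ <;> decide
  · rw [List.perm_iff_count]
    intro a
    fin_cases a <;> simp [List.count_replicate, h₀, h₁, h₂]

/-- Along equal letters the counter changes linearly, so nonnegativity at both ends gives it in
between. The final state is only bounded by `a` because for `n = 0` it stays `i`. -/
theorem run_replicate_abcControl {acc : Set (Fin 3 ⊕ Bool)} {start : Fin 3 ⊕ Bool} (a : Fin 3)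
    (n : ℕ) (i : Fin 3) (hi : i ≤ a) (Ω : Multiplicative ℝ) (h₀ : 0 ≤ Ω.toAdd)
    (h₁ : 0 ≤ Ω.toAdd + n * abcChange p q a) (τ : List (TapeSymbol (Fin 3))) :
    ∃ i' ≤ a, Relation.ReflTransGen ((abcControl (hP := hP) hp hq).toMachine 1 start acc).Step
      ⟨(.inl i, 0), (List.replicate n a).map TapeSymbol.letter ++ τ, Ω⟩
      ⟨(.inl i', 0), τ, Multiplicative.ofAdd (Ω.toAdd + n * abcChange p q a)⟩ := by
  induction n generalizing i Ω with
  | zero => exact ⟨i, hi, by simpa using .refl⟩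
  | succ n ih =>
    have hn : (abcControl (hP := hP) hp hq).next (.inl i) (.letter a) = .inl a := by
      simp [abcControl, hi]
    have hr := BlockControl.run_block (start := start) (acc := acc)
      (abcControl_length (hP := hP) (hp := hp) (hq := hq)) (.inl i) (.letter a)
      ((List.replicate n a).map TapeSymbol.letter ++ τ) Ω (safe_abcControl _ _ _ h₀)
    rw [hn] at hr
    set Ω' := effect ((abcControl (hP := hP) hp hq).ops (.inl i) (.letter a)) * Ω with hΩ'
    have he : Ω'.toAdd = abcChange p q a + Ω.toAdd := by
      rw [hΩ', toAdd_mul, toAdd_effect_abcControl]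
    push_cast at h₁
    have hpos : 0 ≤ Ω'.toAdd := by
      rw [he]
      rcases le_total 0 (abcChange p q a) with h | h
      · exact add_nonneg h h₀
      · nlinarith [mul_nonneg (Nat.cast_nonneg (α := ℝ) n) (neg_nonneg.2 h)]
    obtain ⟨i', hi', hr'⟩ := ih a le_rfl Ω' hpos (by rw [he]; linarith)
    refine ⟨i', hi', ?_⟩
    rw [List.replicate_succ, List.map_cons, List.cons_append]
    have hfin : Ω.toAdd + ((n + 1 : ℕ) : ℝ) * abcChange p q a =
        Ω'.toAdd + n * abcChange p q a := by
      rw [he]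
      push_cast
      ring
    rw [hfin]
    exact hr.trans hr'

theorem language_abcControl (hpq : p ≠ q) :
    ((abcControl (hP := hP) hp hq).toMachine 1 (.inl 0) {.inr true}).language =
      {w | ∃ n : ℕ, w = List.replicate n 0 ++ List.replicate n 1 ++ List.replicate n 2} := by
  ext w
  constructor
  · intro h
    obtain ⟨h₁, h₂⟩ := BlockControl.outcome_of_accepts abcControl_length h
    rw [OnePBDC.tape, BlockControl.outcome] at h₁ h₂
    obtain ⟨-, hw, hsum⟩ := outcome_abcControl w 0 h₁
    have h₃ := congrArg Multiplicative.toAdd h₂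
    rw [toAdd_mul] at h₃
    have h₄ : (effect ((abcControl (hP := hP) hp hq).ops (.inl 0) .leftEnd)).toAdd = √p := by
      simp [abcControl, BlockControl.ops, effect, Operation.push]
    rw [h₄] at h₃
    have h₅ := hsum.symm.trans (eq_sub_of_add_eq h₃)
    rw [toAdd_one, sum_map_abcChange] at h₅
    -- The contributions of the end-markers have cancelled; what vanishes is the combination of `√p`
    -- and `√q` whose coefficients are differences of letter counts.
    obtain ⟨hx, hy⟩ := int_combination_sqrt_primes (hP p hp) (hP q hq) hpq
      (sub_left_inj.1 h₅)
    exact ⟨w.count 0, eq_replicate_of_pairwise hw rfl (by omega) (by omega)⟩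
  · rintro ⟨n, rfl⟩
    have hp₀ := Real.sqrt_nonneg (p : ℝ)
    have hq₀ := Real.sqrt_nonneg (q : ℝ)
    have hn : (0 : ℝ) ≤ n := Nat.cast_nonneg n
    have hnp := mul_nonneg hn hp₀
    have hnq := mul_nonneg hn hq₀
    refine ⟨(.inr true, 0), rfl, ?_⟩
    simp only [OnePBDC.tape, List.map_append, List.append_assoc]
    have r₀ := BlockControl.run_block (start := .inl 0) (acc := {.inr true})
      (abcControl_length (hP := hP) (hp := hp) (hq := hq)) (.inl 0) .leftEnd
      ((List.replicate n 0).map TapeSymbol.letter ++ ((List.replicate n 1).map TapeSymbol.letter ++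
        ((List.replicate n 2).map TapeSymbol.letter ++ [.rightEnd]))) 1
      (safe_abcControl _ _ _ le_rfl)
    have e₀ : effect ((abcControl (hP := hP) hp hq).ops (.inl 0) .leftEnd) * 1 =
        Multiplicative.ofAdd √p := by
      simp [abcControl, BlockControl.ops, effect, Operation.push]
    rw [e₀] at r₀
    obtain ⟨i, hi, r₁⟩ := run_replicate_abcControl (hP := hP) (hp := hp) (hq := hq)
      (start := .inl 0) (acc := {.inr true}) 0 n 0 le_rfl (Multiplicative.ofAdd √p)
      (by simp) (by simp [abcChange]; nlinarith)
      ((List.replicate n 1).map TapeSymbol.letter ++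
        ((List.replicate n 2).map TapeSymbol.letter ++ [.rightEnd]))
    obtain ⟨j, hj, r₂⟩ := run_replicate_abcControl (hP := hP) (hp := hp) (hq := hq)
      (start := .inl 0) (acc := {.inr true}) 1 n i (hi.trans (by decide))
      (Multiplicative.ofAdd (√p + n * abcChange p q 0))
      (by simp [abcChange]; nlinarith) (by simp [abcChange]; nlinarith)
      ((List.replicate n 2).map TapeSymbol.letter ++ [.rightEnd])
    obtain ⟨k, hk, r₃⟩ := run_replicate_abcControl (hP := hP) (hp := hp) (hq := hq)
      (start := .inl 0) (acc := {.inr true}) 2 n j (hj.trans (by decide))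
      (Multiplicative.ofAdd (√p + n * abcChange p q 0 + n * abcChange p q 1))
      (by simp [abcChange]; nlinarith) (by simp [abcChange]; nlinarith)
      [.rightEnd]
    have r₄ := BlockControl.run_block (start := .inl 0) (acc := {.inr true})
      (abcControl_length (hP := hP) (hp := hp) (hq := hq)) (.inl k) .rightEnd [] _
      (safe_abcControl (hP := hP) (hp := hp) (hq := hq) (.inl k) .rightEnd
        (Multiplicative.ofAdd √p) (by simp))
    have e₃ : √(p : ℝ) + n * abcChange p q 0 + n * abcChange p q 1 + n * abcChange p q 2 = √p := by
      simp [abcChange]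
      ring
    simp only [toAdd_ofAdd, e₃] at r₁ r₂ r₃
    have e₄ : effect ((abcControl (hP := hP) hp hq).ops (.inl k) .rightEnd) *
        Multiplicative.ofAdd √p = 1 := by
      simp [abcControl, BlockControl.ops, effect, Operation.pop]
    rw [e₄] at r₄
    exact (((r₀.trans r₁).trans r₂).trans r₃).trans r₄

end

theorem abcLanguage_mem_classOf_realCounter {P : Finset ℕ} (hP : ∀ p ∈ P, p.Prime)
    (hcard : 1 < P.card) : abcLanguage ∈ classOf (realCounter P hP) := by
  obtain ⟨p, hp, q, hq, hpq⟩ := Finset.one_lt_card.1 hcard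
  exact ⟨_, inferInstance, _, language_abcControl (hp := hp) (hq := hq) hpq⟩

/-! ### Recognizing palindromes with a free pair of generators -/

theorem List.flatMap_injective_of_length {α β : Type} {f : α → List β} (hf : Function.Injective f)
    {n : ℕ} (hn : n ≠ 0) (hlen : ∀ a, (f a).length = n) :
    Function.Injective fun l : List α => l.flatMap f := by
  intro l l' h
  simp only at h
  induction l generalizing l' with
  | nil =>
    rcases l' with _ | ⟨b, l'⟩
    · rfl
    · have := congrArg List.length h
      rw [List.flatMap_cons, List.length_append, hlen, List.flatMap_nil, List.length_nil] at this
      omega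
  | cons a l ih =>
    rcases l' with _ | ⟨b, l'⟩
    · have := congrArg List.length h
      rw [List.flatMap_cons, List.length_append, hlen, List.flatMap_nil, List.length_nil] at this
      omega
    · rw [List.flatMap_cons, List.flatMap_cons] at h
      obtain ⟨h₁, h₂⟩ := List.append_inj h (by rw [hlen, hlen])
      rw [hf h₁, ih h₂]

/-- The one-hot word of a letter. -/
def oneHot {s : ℕ} (i : Fin s) : List Bool := List.ofFn fun j => decide (j = i)

theorem oneHot_injective {s : ℕ} : Function.Injective (oneHot (s := s)) := by
  intro i j h
  have := congrFun (List.ofFn_injective h) i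
  simpa using this

/-- The code word of a letter, a one-hot word between two bits `true`. -/
def letterCode {s : ℕ} (i : Fin s) : List Bool := true :: (oneHot i ++ [true])

/-- The reversed code word of a letter. -/
def reverseCode {s : ℕ} (i : Fin s) : List Bool := true :: ((oneHot i).reverse ++ [true])

theorem reverse_letterCode {s : ℕ} (i : Fin s) : (letterCode i).reverse = reverseCode i := by
  simp [letterCode, reverseCode]

theorem flatMap_reverseCode_injective {s : ℕ} :
    Function.Injective fun x : List (Fin s) => x.flatMap reverseCode := by
  refine List.flatMap_injective_of_length (n := s + 2) ?_ (by omega) ?_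
  · intro i j h
    rw [← reverse_letterCode, ← reverse_letterCode, List.reverse_inj] at h
    simp only [letterCode, List.cons.injEq, true_and, List.append_cancel_right_eq] at h
    exact oneHot_injective h
  · intro i
    simp [reverseCode, oneHot]

section

variable {U : Type} [Group U] {C : GeneralizedCounter U} {g : Bool → U} (hg : ∀ b, g b ∈ C.gen)

/-- The group element of a stack of bits. -/
def stackValue (g : Bool → U) (l : List Bool) : U := (l.map g).prod

theorem stackValue_append (l l' : List Bool) :
    stackValue g (l ++ l') = stackValue g l * stackValue g l' := by
  simp [stackValue]

/-- The operations that push the bits of a word. -/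
def pushWord (l : List Bool) : List C.Operation := l.map fun b => .push (g b) (hg b)

/-- The operations that pop the bits of a word. -/
def popWord (l : List Bool) : List C.Operation := l.map fun b => .pop (g b) (hg b)

theorem effect_pushWord (l : List Bool) :
    effect (pushWord hg l) = stackValue g l.reverse := by
  induction l with
  | nil => rfl
  | cons b l ih =>
    rw [List.reverse_cons, stackValue_append, ← ih]
    change effect (pushWord hg l) * g b = _
    simp [stackValue]

theorem effect_popWord (l : List Bool) : effect (popWord hg l) = (stackValue g l)⁻¹ := by
  induction l with
  | nil => simp [popWord, effect, stackValue]
  | cons b l ih =>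
    change effect (popWord hg l) * (g b)⁻¹ = _
    rw [ih, ← mul_inv_rev]
    rfl

/-- A nonempty stack lies in `G*`, which is disjoint from the negative elements. The empty stack is
the identity, which the axioms of a counter do not keep out of `neg`; hence the hypothesis `h₁`. -/
theorem stackValue_notMem_neg (hg : ∀ b, g b ∈ C.gen) (h₁ : (1 : U) ∉ C.neg)
    (l : List Bool) : stackValue g l ∉ C.neg := by
  rcases eq_or_ne l [] with rfl | hl
  · exact h₁
  · refine fun h => Set.disjoint_left.1 C.neg_disjoint h ?_
    clear h
    induction l with
    | nil => exact absurd rfl hl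
    | cons b l ih =>
      have hb : g b ∈ Subsemigroup.closure (C.gen : Set U) := Subsemigroup.subset_closure (hg b)
      rcases eq_or_ne l [] with rfl | hl'
      · simpa [stackValue] using hb
      · exact mul_mem hb (ih hl')

theorem safe_pushWord (h₁ : (1 : U) ∉ C.neg) (l t : List Bool) :
    Safe (pushWord hg l) (stackValue g t) := by
  induction l generalizing t with
  | nil => trivial
  | cons b l ih =>
    refine ⟨stackValue_notMem_neg hg h₁ t, ?_⟩
    exact ih (b :: t)

theorem safe_popWord (h₁ : (1 : U) ∉ C.neg) (l t : List Bool) :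
    Safe (popWord hg l) (stackValue g (l ++ t)) := by
  induction l with
  | nil => trivial
  | cons b l ih =>
    refine ⟨stackValue_notMem_neg hg h₁ _, ?_⟩
    have : (Operation.pop (g b) (hg b)).val * stackValue g (b :: l ++ t) =
        stackValue g (l ++ t) := by
      simp [Operation.pop, stackValue]
    rw [this]
    exact ih

/-- The control for `x # xᴿ`: in the state `inl false` the codes of the letters are pushed, and in
the state `inl true` they are popped. -/
def palControl (s : ℕ) : BlockControl C (Fin (s + 1)) (Bool ⊕ Bool) where
  next
    | .inl b, .leftEnd => .inl b
    | .inl false, .letter a => Fin.lastCases (.inl true) (fun _ => .inl false) a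
    | .inl true, .letter a => Fin.lastCases (.inr false) (fun _ => .inl true) a
    | .inl false, .rightEnd => .inr false
    | .inl true, .rightEnd => .inr true
    | .inr _, _ => .inr false
  block
    | _, .leftEnd => (.push (g true) (hg true), [])
    | .inl true, .letter a =>
      Fin.lastCases (.push (g true) (hg true), [.pop (g true) (hg true)])
        (fun i => (.pop (g true) (hg true), popWord hg ((oneHot i).reverse ++ [true]))) a
    | _, .letter a =>
      Fin.lastCases (.push (g true) (hg true), [.pop (g true) (hg true)])
        (fun i => (.push (g true) (hg true), pushWord hg (oneHot i ++ [true]))) a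
    | _, .rightEnd => (.pop (g true) (hg true), [])

theorem palControl_ops_leftEnd (s : ℕ) (q : Bool ⊕ Bool) :
    (palControl hg s).ops q .leftEnd = pushWord hg [true] := by
  rcases q with b | b <;> rfl

theorem palControl_ops_rightEnd (s : ℕ) (q : Bool ⊕ Bool) :
    (palControl hg s).ops q .rightEnd = popWord hg [true] := by
  rcases q with (_ | _) | b <;> rfl

theorem palControl_ops_push {s : ℕ} (i : Fin s) :
    (palControl hg s).ops (.inl false) (.letter i.castSucc) = pushWord hg (letterCode i) := by
  simp [palControl, BlockControl.ops, letterCode, pushWord]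

theorem palControl_ops_pop {s : ℕ} (i : Fin s) :
    (palControl hg s).ops (.inl true) (.letter i.castSucc) = popWord hg (reverseCode i) := by
  simp [palControl, BlockControl.ops, reverseCode, popWord]

theorem palControl_ops_last (s : ℕ) (q : Bool ⊕ Bool) :
    (palControl hg s).ops q (.letter (Fin.last s)) = pushWord hg [true] ++ popWord hg [true] := by
  rcases q with (_ | _) | b <;> simp [palControl, BlockControl.ops, popWord, pushWord]

theorem effect_palControl_last (s : ℕ) (q : Bool ⊕ Bool) :
    effect ((palControl hg s).ops q (.letter (Fin.last s))) = 1 := by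
  rw [palControl_ops_last]
  change (1 * (g true)⁻¹) * g true = 1
  simp

theorem palControl_length (s : ℕ) (q : Bool ⊕ Bool) (σ : TapeSymbol (Fin (s + 1))) :
    ((palControl hg s).ops q σ).length ≤ (s + 1) + 1 := by
  rcases σ with _ | a | _
  · simp [palControl_ops_leftEnd, pushWord]
  · induction a using Fin.lastCases with
    | last => simp [palControl_ops_last, pushWord, popWord]
    | cast i =>
      rcases q with (_ | _) | b <;>
        simp [palControl, BlockControl.ops, pushWord, popWord, oneHot]
  · simp [palControl_ops_rightEnd, popWord]

theorem outcome_palControl_dead {s : ℕ} (b : Bool) (σ : TapeSymbol (Fin (s + 1)))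
    (l : List (TapeSymbol (Fin (s + 1)))) :
    ((palControl hg s).outcome (.inr b) (σ :: l)).1 = .inr false := by
  induction l generalizing b σ with
  | nil => simp [BlockControl.outcome, palControl]
  | cons τ l ih =>
    rw [BlockControl.outcome]
    exact ih false τ

theorem outcome_palControl_pop {s : ℕ} (w : List (Fin (s + 1)))
    (h : ((palControl hg s).outcome (.inl true)
      (w.map TapeSymbol.letter ++ [TapeSymbol.rightEnd])).1 = .inr true) :
    ∃ y : List (Fin s), w = y.map Fin.castSucc ∧
      ((palControl hg s).outcome (.inl true)
        (w.map TapeSymbol.letter ++ [TapeSymbol.rightEnd])).2 =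
        (stackValue g (y.flatMap reverseCode ++ [true]))⁻¹ := by
  induction w with
  | nil =>
    refine ⟨[], rfl, ?_⟩
    rw [List.map_nil, List.nil_append, BlockControl.outcome, palControl_ops_rightEnd,
      effect_popWord]
    simp [BlockControl.outcome]
  | cons a w ih =>
    rw [List.map_cons, List.cons_append, BlockControl.outcome] at h ⊢
    induction a using Fin.lastCases with
    | last =>
      have hn : (palControl hg s).next (.inl true) (.letter (Fin.last s)) = .inr false := by
        simp [palControl]
      rw [hn] at h
      rcases w with _ | ⟨b, w⟩
      · rw [List.map_nil, List.nil_append, outcome_palControl_dead] at h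
        simp at h
      · rw [List.map_cons, List.cons_append, outcome_palControl_dead] at h
        simp at h
    | cast i =>
      have hn : (palControl hg s).next (.inl true) (.letter i.castSucc) = .inl true := by
        simp [palControl]
      rw [hn] at h ⊢
      obtain ⟨y, rfl, hy⟩ := ih h
      refine ⟨i :: y, rfl, ?_⟩
      rw [hy, palControl_ops_pop, effect_popWord, List.flatMap_cons, List.append_assoc,
        stackValue_append (reverseCode i), mul_inv_rev]

/-- Pushing reverses a code word, so `x` leaves on the stack the reversed codes of its letters, last
letter on top. Popping uses reversed codes as well, so the two factors are values of words under one
and the same code. -/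
theorem outcome_palControl_push {s : ℕ} (w : List (Fin (s + 1)))
    (h : ((palControl hg s).outcome (.inl false)
      (w.map TapeSymbol.letter ++ [TapeSymbol.rightEnd])).1 = .inr true) :
    ∃ x y : List (Fin s), w = x.map Fin.castSucc ++ [Fin.last s] ++ y.map Fin.castSucc ∧
      ((palControl hg s).outcome (.inl false)
        (w.map TapeSymbol.letter ++ [TapeSymbol.rightEnd])).2 =
        (stackValue g (y.flatMap reverseCode ++ [true]))⁻¹ *
          stackValue g (x.reverse.flatMap reverseCode) := by
  induction w with
  | nil => simp [BlockControl.outcome, palControl] at h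
  | cons a w ih =>
    rw [List.map_cons, List.cons_append, BlockControl.outcome] at h ⊢
    induction a using Fin.lastCases with
    | last =>
      have hn : (palControl hg s).next (.inl false) (.letter (Fin.last s)) = .inl true := by
        simp [palControl]
      rw [hn] at h ⊢
      obtain ⟨y, rfl, hy⟩ := outcome_palControl_pop hg w h
      refine ⟨[], y, rfl, ?_⟩
      rw [hy, effect_palControl_last]
      simp [stackValue]
    | cast i =>
      have hn : (palControl hg s).next (.inl false) (.letter i.castSucc) = .inl false := by
        simp [palControl]
      rw [hn] at h ⊢
      obtain ⟨x, y, rfl, hy⟩ := ih h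
      refine ⟨i :: x, y, rfl, ?_⟩
      rw [hy, palControl_ops_push, effect_pushWord, reverse_letterCode, mul_assoc,
        ← stackValue_append]
      simp

theorem run_push_palControl {s : ℕ} {start : Bool ⊕ Bool} {acc : Set (Bool ⊕ Bool)}
    (h₁ : (1 : U) ∉ C.neg) (x : List (Fin s)) (t : List Bool)
    (τ : List (TapeSymbol (Fin (s + 1)))) :
    Relation.ReflTransGen ((palControl hg s).toMachine (s + 1) start acc).Step
      ⟨(.inl false, 0), (x.map Fin.castSucc).map TapeSymbol.letter ++ τ, stackValue g t⟩
      ⟨(.inl false, 0), τ, stackValue g (x.reverse.flatMap reverseCode ++ t)⟩ := by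
  induction x generalizing t with
  | nil => exact .refl
  | cons i x ih =>
    have hn : (palControl hg s).next (.inl false) (.letter i.castSucc) = .inl false := by
      simp [palControl]
    have hr := BlockControl.run_block (start := start) (acc := acc) (palControl_length hg s)
      (.inl false) (.letter i.castSucc) ((x.map Fin.castSucc).map TapeSymbol.letter ++ τ)
      (stackValue g t) (by rw [palControl_ops_push]; exact safe_pushWord hg h₁ _ _)
    rw [hn, palControl_ops_push, effect_pushWord, reverse_letterCode, ← stackValue_append] at hr
    have hr' := hr.trans (ih _)
    simpa using hr'

theorem run_pop_palControl {s : ℕ} {start : Bool ⊕ Bool} {acc : Set (Bool ⊕ Bool)}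
    (h₁ : (1 : U) ∉ C.neg) (y : List (Fin s)) (t : List Bool)
    (τ : List (TapeSymbol (Fin (s + 1)))) :
    Relation.ReflTransGen ((palControl hg s).toMachine (s + 1) start acc).Step
      ⟨(.inl true, 0), (y.map Fin.castSucc).map TapeSymbol.letter ++ τ,
        stackValue g (y.flatMap reverseCode ++ t)⟩
      ⟨(.inl true, 0), τ, stackValue g t⟩ := by
  induction y with
  | nil => exact .refl
  | cons i y ih =>
    have hn : (palControl hg s).next (.inl true) (.letter i.castSucc) = .inl true := by
      simp [palControl]
    have hr := BlockControl.run_block (start := start) (acc := acc) (palControl_length hg s)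
      (.inl true) (.letter i.castSucc) ((y.map Fin.castSucc).map TapeSymbol.letter ++ τ)
      (stackValue g (reverseCode i ++ (y.flatMap reverseCode ++ t)))
      (by rw [palControl_ops_pop]; exact safe_popWord hg h₁ _ _)
    rw [hn, palControl_ops_pop, effect_popWord, stackValue_append, inv_mul_cancel_left,
      ← stackValue_append] at hr
    have hr' := hr.trans ih
    simpa using hr'

/-- The counter ends with the identity exactly when the pushed and the popped stack have equal
values. Freeness makes them equal as words, and the code, being injective of fixed length, then
gives `y = xᴿ`. Conversely, on `x # xᴿ` all intermediate contents are values of stacks, so no crash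
occurs. -/
theorem language_palControl (h₁ : (1 : U) ∉ C.neg) (hfree : Function.Injective (stackValue g))
    (s : ℕ) :
    ((palControl hg s).toMachine (s + 1) (.inl false) {.inr true}).language =
      {w | ∃ x : List (Fin s),
        w = x.map Fin.castSucc ++ [Fin.last s] ++ x.reverse.map Fin.castSucc} := by
  have hl : (palControl hg s).next (.inl false) .leftEnd = .inl false := rfl
  ext w
  constructor
  · intro h
    obtain ⟨h₂, h₃⟩ := BlockControl.outcome_of_accepts (palControl_length hg s) h
    rw [OnePBDC.tape, BlockControl.outcome, hl] at h₂ h₃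
    obtain ⟨x, y, rfl, hxy⟩ := outcome_palControl_push hg w h₂
    simp only [hxy, palControl_ops_leftEnd, effect_pushWord] at h₃
    rw [mul_assoc, ← stackValue_append, inv_mul_eq_one] at h₃
    have h₄ := hfree h₃
    rw [List.reverse_singleton, List.append_cancel_right_eq] at h₄
    rw [flatMap_reverseCode_injective h₄]
    exact ⟨x, rfl⟩
  · rintro ⟨x, rfl⟩
    refine ⟨(.inr true, 0), rfl, ?_⟩
    have r₀ := BlockControl.run_block (start := .inl false) (acc := {.inr true})
      (palControl_length hg s) (.inl false) .leftEnd
      ((x.map Fin.castSucc).map TapeSymbol.letter ++ (TapeSymbol.letter (Fin.last s) ::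
        ((x.reverse.map Fin.castSucc).map TapeSymbol.letter ++ [.rightEnd]))) (stackValue g [])
      (by rw [palControl_ops_leftEnd]; exact safe_pushWord hg h₁ _ _)
    rw [palControl_ops_leftEnd, effect_pushWord, ← stackValue_append, hl] at r₀
    have r₁ := run_push_palControl (start := .inl false) (acc := {.inr true}) hg h₁ x
      ([true].reverse ++ []) (TapeSymbol.letter (Fin.last s) ::
        ((x.reverse.map Fin.castSucc).map TapeSymbol.letter ++ [.rightEnd]))
    set t := x.reverse.flatMap reverseCode ++ ([true].reverse ++ []) with ht
    have r₂ := BlockControl.run_block (start := .inl false) (acc := {.inr true})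
      (palControl_length hg s) (.inl false) (.letter (Fin.last s))
      ((x.reverse.map Fin.castSucc).map TapeSymbol.letter ++ [.rightEnd]) (stackValue g t)
      (by
        rw [palControl_ops_last]
        refine ⟨stackValue_notMem_neg hg h₁ t, ?_⟩
        exact safe_popWord hg h₁ [true] t)
    have hn : (palControl hg s).next (.inl false) (.letter (Fin.last s)) = .inl true := by
      simp [palControl]
    rw [effect_palControl_last, one_mul, hn] at r₂
    have r₃ := run_pop_palControl (start := .inl false) (acc := {.inr true}) hg h₁ x.reverse
      ([true].reverse ++ []) [.rightEnd]
    have r₄ := BlockControl.run_block (start := .inl false) (acc := {.inr true})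
      (palControl_length hg s) (.inl true) .rightEnd [] (stackValue g ([true].reverse ++ []))
      (by rw [palControl_ops_rightEnd]; exact safe_popWord hg h₁ [true] [])
    have e₄ : effect ((palControl hg s).ops (.inl true) .rightEnd) *
        stackValue g ([true].reverse ++ []) = 1 := by
      rw [palControl_ops_rightEnd, effect_popWord]
      simp
    rw [e₄] at r₄
    have r := (((r₀.trans r₁).trans r₂).trans r₃).trans r₄
    have e : (OnePBDC.tape (x.map Fin.castSucc ++ [Fin.last s] ++ x.reverse.map Fin.castSucc)) =
        TapeSymbol.leftEnd :: ((x.map Fin.castSucc).map TapeSymbol.letter ++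
          (TapeSymbol.letter (Fin.last s) ::
            ((x.reverse.map Fin.castSucc).map TapeSymbol.letter ++ [.rightEnd]))) := by
      simp [OnePBDC.tape]
    rw [e]
    exact r

theorem palLanguage_mem_classOf (hg : ∀ b, g b ∈ C.gen) (h₁ : (1 : U) ∉ C.neg)
    (hfree : Function.Injective (stackValue g)) (s : ℕ) : palLanguage s ∈ classOf C :=
  ⟨_, inferInstance, _, language_palControl hg h₁ hfree s⟩

end

/-! ### A matrix counter with free generators -/

/-- The size is the Frobenius norm. Submultiplicativity keeps products of inverse generators below
size 1. -/
theorem matrixSize_mul_le {m : ℕ} (X Y : Matrix.GeneralLinearGroup (Fin m) ℝ) :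
    matrixSize (X * Y) ≤ matrixSize X * matrixSize Y := by
  let := Matrix.frobeniusSeminormedAddCommGroup (m := Fin m) (n := Fin m) (α := ℝ)
  have h : ∀ X : Matrix.GeneralLinearGroup (Fin m) ℝ, matrixSize X = ‖X.val‖ := by
    intro X
    rw [Matrix.frobenius_norm_def, matrixSize, Real.sqrt_eq_rpow]
    simp
  rw [h, h, h]
  exact Matrix.frobenius_norm_mul X.val Y.val

theorem abs_apply_le_matrixSize {m : ℕ} (X : Matrix.GeneralLinearGroup (Fin m) ℝ) (i j : Fin m) :
    |X.val i j| ≤ matrixSize X := by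
  refine Real.le_sqrt_of_sq_le ?_
  have h₁ := Finset.single_le_sum (f := fun j => |X.val i j| ^ 2) (s := Finset.univ)
    (fun _ _ => by positivity) (Finset.mem_univ j)
  have h₂ := Finset.single_le_sum (f := fun i => ∑ j, |X.val i j| ^ 2) (s := Finset.univ)
    (fun _ _ => by positivity) (Finset.mem_univ i)
  exact h₁.trans h₂

/-- Twice the matrix of the affine map `x ↦ k x + i`. -/
noncomputable def affineMatrix (k : ℕ) (hk : 2 ≤ k) (i : ℕ) :
    Matrix.GeneralLinearGroup (Fin 2) ℝ :=
  Matrix.GeneralLinearGroup.mkOfDetNeZero !![2 * k, 2 * i; 0, 2] (by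
    rw [Matrix.det_fin_two_of]
    have : (0 : ℝ) < k := by positivity
    simp [this.ne'])

theorem affineMatrix_val {k : ℕ} (hk : 2 ≤ k) (i : ℕ) :
    (affineMatrix k hk i).val = !![2 * (k : ℝ), 2 * i; 0, 2] := rfl

theorem affineMatrix_injective {k : ℕ} (hk : 2 ≤ k) : Function.Injective (affineMatrix k hk) := by
  intro i j h
  have := congrArg (fun X => X.val 0 1) h
  simpa [affineMatrix_val] using this

/-- The squared size is at most `1/16 + 1/4 + 1/4`. Here the factor 2 in `affineMatrix` is
essential: without it the inverse has a corner entry 1 and size at least 1. -/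
theorem matrixSize_inv_affineMatrix_lt_one {k : ℕ} (hk : 2 ≤ k) {i : ℕ} (hi : i < k) :
    matrixSize (affineMatrix k hk i)⁻¹ < 1 := by
  have hk₀ : (0 : ℝ) < k := by positivity
  have hinv : (affineMatrix k hk i)⁻¹.val =
      !![1 / (2 * (k : ℝ)), -(i / (2 * k)); 0, 1 / 2] := by
    rw [Matrix.coe_units_inv, affineMatrix_val]
    refine Matrix.inv_eq_right_inv ?_
    ext a b
    fin_cases a <;> fin_cases b <;> simp [Matrix.mul_apply, Fin.sum_univ_two]
    · field_simp
    · field_simp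
      ring
  have hi' : (i : ℝ) ≤ k - 1 := by
    have : (i : ℝ) + 1 ≤ k := by exact_mod_cast hi
    linarith
  have hk' : (2 : ℝ) ≤ k := by exact_mod_cast hk
  rw [matrixSize, hinv, Real.sqrt_lt' one_pos]
  simp only [Fin.sum_univ_two, sq_abs]
  simp
  have h₁ : ((k : ℝ)⁻¹ * 2⁻¹) ^ 2 ≤ 1 / 16 := by
    have : (k : ℝ)⁻¹ ≤ 2⁻¹ := inv_anti₀ (by norm_num) hk'
    have h₀ : 0 < (k : ℝ)⁻¹ := by positivity
    nlinarith
  have h₂ : ((i : ℝ) / (2 * k)) ^ 2 ≤ 1 / 4 := by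
    have h₃ : (i : ℝ) / (2 * k) ≤ 1 / 2 := by
      rw [div_le_div_iff₀ (by positivity) (by norm_num)]
      linarith
    have h₄ : 0 ≤ (i : ℝ) / (2 * k) := by positivity
    nlinarith
  norm_num at h₁ h₂ ⊢
  linarith

/-- The counter generated by the `k` matrices `affineMatrix k i`. -/
noncomputable def affineCounter (k : ℕ) (hk : 2 ≤ k) :
    GeneralizedCounter (Matrix.GeneralLinearGroup (Fin 2) ℝ) :=
  have hpos : ∀ X ∈ Subsemigroup.closure
      (((Finset.range k).map ⟨affineMatrix k hk, affineMatrix_injective hk⟩ : Finset _) :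
        Set (Matrix.GeneralLinearGroup (Fin 2) ℝ)), 1 ≤ matrixSize X := by
    intro X hX
    -- The zero below the diagonal makes the lower corner entry multiplicative, so it stays at least
    -- 1 and bounds the size from below.
    have : X.val 1 0 = 0 ∧ 1 ≤ X.val 1 1 := by
      induction hX using Subsemigroup.closure_induction with
      | mem X hX =>
        obtain ⟨i, -, rfl⟩ := Finset.mem_map.1 (Finset.mem_coe.1 hX)
        simp [affineMatrix_val]
      | mul X Y _ _ hX hY =>
        rw [Units.val_mul, Matrix.mul_apply, Matrix.mul_apply, Fin.sum_univ_two,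
          Fin.sum_univ_two, hX.1, hY.1]
        refine ⟨by ring, ?_⟩
        nlinarith [hX.2, hY.2]
    exact this.2.trans ((le_abs_self _).trans (abs_apply_le_matrixSize X 1 1))
  have hneg : ∀ X ∈ Subsemigroup.closure {X : Matrix.GeneralLinearGroup (Fin 2) ℝ |
      X⁻¹ ∈ (Finset.range k).map ⟨affineMatrix k hk, affineMatrix_injective hk⟩},
      matrixSize X < 1 := by
    intro X hX
    induction hX using Subsemigroup.closure_induction with
    | mem X hX =>
      obtain ⟨i, hi, h⟩ := Finset.mem_map.1 (Set.mem_ofPred_eq ▸ hX)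
      rw [← inv_inv X, ← h]
      exact matrixSize_inv_affineMatrix_lt_one hk (Finset.mem_range.1 hi)
    | mul X Y _ _ hX hY =>
      exact (matrixSize_mul_le X Y).trans_lt
        (mul_lt_one_of_nonneg_of_lt_one_left (Real.sqrt_nonneg _) hX hY.le)
  { gen := (Finset.range k).map ⟨affineMatrix k hk, affineMatrix_injective hk⟩
    neg := {X | matrixSize X < 1}
    closure_disjoint := Set.disjoint_left.2 fun X h₁ h₂ => (hneg X h₂).not_ge (hpos X h₁)
    neg_disjoint := Set.disjoint_left.2 fun X h₁ h₂ => (hpos X h₂).not_gt h₁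
    inv_closure_subset := hneg }

theorem isMatrixCounter_affineCounter {k : ℕ} (hk : 2 ≤ k) :
    IsMatrixCounter k (affineCounter k hk) :=
  ⟨(Finset.card_map _).trans (Finset.card_range k), rfl⟩

/-- Only the digits 0 and 1 serve as stack symbols; the remaining generators bring the number up to
`k`. -/
theorem affineMatrix_toNat_mem_gen {k : ℕ} (hk : 2 ≤ k) (b : Bool) :
    affineMatrix k hk b.toNat ∈ (affineCounter k hk).gen :=
  Finset.mem_map_of_mem ⟨affineMatrix k hk, affineMatrix_injective hk⟩
    (Finset.mem_range.2 ((Bool.toNat_lt b).trans_le hk))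

theorem one_notMem_neg_affineCounter {k : ℕ} (hk : 2 ≤ k) : 1 ∉ (affineCounter k hk).neg := by
  refine not_lt.2 (le_trans ?_ (abs_apply_le_matrixSize _ 1 1))
  simp

/-- Composing the maps `x ↦ k x + b` performs Horner's scheme, so the translation part is the number
with the bits as base `k` digits, top of the stack least significant. -/
theorem stackValue_affineMatrix {k : ℕ} (hk : 2 ≤ k) (l : List Bool) :
    (stackValue (fun b => affineMatrix k hk b.toNat) l).val =
      (2 : ℝ) ^ l.length • !![(k : ℝ) ^ l.length,
        ((Nat.ofDigits k (l.map Bool.toNat) : ℕ) : ℝ); 0, 1] := by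
  induction l with
  | nil =>
    ext a b
    fin_cases a <;> fin_cases b <;> simp [stackValue]
  | cons b l ih =>
    rw [stackValue, List.map_cons, List.prod_cons, Units.val_mul, ← stackValue, ih,
      affineMatrix_val]
    ext a c
    fin_cases a <;> fin_cases c <;>
      simp [Matrix.mul_apply, Fin.sum_univ_two, Nat.ofDigits_cons] <;> ring

/-- The corner entry `2 ^ l.length` gives the length, which the number alone misses because of
leading zeros. Among words of equal length, the base `k` digits are unique. -/
theorem stackValue_affineMatrix_injective {k : ℕ} (hk : 2 ≤ k) :
    Function.Injective (stackValue fun b => affineMatrix k hk b.toNat) := by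
  intro l l' h
  have hv := congrArg Units.val h
  rw [stackValue_affineMatrix, stackValue_affineMatrix] at hv
  have h₁ := congrFun (congrFun hv 1) 1
  have h₂ := congrFun (congrFun hv 0) 1
  simp at h₁ h₂
  rw [h₁] at h₂
  have h₃ : Nat.ofDigits k (l.map Bool.toNat) = Nat.ofDigits k (l'.map Bool.toNat) := by
    simpa using h₂
  have hlt : ∀ l : List Bool, ∀ d ∈ l.map Bool.toNat, d < k := by
    intro l d hd
    obtain ⟨b, -, rfl⟩ := List.mem_map.1 hd
    exact (Bool.toNat_lt b).trans_le hk
  have h₄ := Nat.ofDigits_inj_of_len_eq (by omega) (by simpa using h₁) (hlt l) (hlt l') h₃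
  exact List.map_injective_iff.2 (fun a b h => by revert a b; decide) h₄

theorem palLanguage_mem_matrixCounterClass {k : ℕ} (hk : 2 ≤ k) (s : ℕ) :
    palLanguage s ∈ matrixCounterClass k :=
  ⟨2, affineCounter k hk, isMatrixCounter_affineCounter hk,
    palLanguage_mem_classOf (affineMatrix_toNat_mem_gen hk) (one_notMem_neg_affineCounter hk)
      (stackValue_affineMatrix_injective hk) s⟩

/-! ### The hierarchy -/

theorem palLanguage_notMem_realCounterClass (k : ℕ) {s : ℕ} (hs : 2 ≤ s) :
    palLanguage s ∉ realCounterClass k := by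
  rintro ⟨P, hP, -, h⟩
  exact palLanguage_notMem_classOf _ hs h

theorem exists_primes_card (k : ℕ) : ∃ P : Finset ℕ, (∀ p ∈ P, p.Prime) ∧ P.card = k := by
  obtain ⟨P, hP, hk⟩ := Nat.infinite_setOfPred_prime.exists_subset_card_eq k
  exact ⟨P, fun p hp => hP hp, hk⟩

theorem integerCounterClass_ssubset_classOf_realCounter {P : Finset ℕ}
    (hP : ∀ p ∈ P, p.Prime) (hcard : 1 < P.card) :
    integerCounterClass ⊂ classOf (realCounter P hP) :=
  (Set.ssubset_iff_of_subset (integerCounterClass_subset_classOf_realCounter hP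
    (Finset.card_pos.1 (by omega)))).2
    ⟨_, abcLanguage_mem_classOf_realCounter hP hcard, abcLanguage_notMem_integerCounterClass⟩

theorem theorem5 (k : ℕ) (hk : 2 ≤ k) :
    -- the hierarchy
    (integerCounterClass ⊂ realCounterClass k ∧ realCounterClass k ⊂ matrixCounterClass k) ∧
    -- the first gap is there for each single choice of the `k` primes
    (∀ (P : Finset ℕ) (hP : ∀ p ∈ P, p.Prime), P.card = k →
      integerCounterClass ⊂ classOf (realCounter P hP) ∧
      abcLanguage ∈ classOf (realCounter P hP)) ∧
    -- the witnesses of the two gaps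
    (abcLanguage ∈ realCounterClass k ∧ abcLanguage ∉ integerCounterClass) ∧
    (∀ s : ℕ, 2 ≤ s →
      palLanguage s ∈ matrixCounterClass k ∧ palLanguage s ∉ realCounterClass k) := by
  obtain ⟨P, hP, hcard⟩ := exists_primes_card k
  have hsub : classOf (realCounter P hP) ⊆ realCounterClass k := fun L hL => ⟨P, hP, hcard, hL⟩
  refine ⟨⟨?_, ?_⟩, ?_, ⟨?_, abcLanguage_notMem_integerCounterClass⟩, ?_⟩
  · exact (integerCounterClass_ssubset_classOf_realCounter hP (by omega)).trans_subset hsub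
  · exact (Set.ssubset_iff_of_subset (realCounterClass_subset_matrixCounterClass k)).2
      ⟨_, palLanguage_mem_matrixCounterClass hk 2, palLanguage_notMem_realCounterClass k le_rfl⟩
  · intro P hP hcard
    exact ⟨integerCounterClass_ssubset_classOf_realCounter hP (by omega),
      abcLanguage_mem_classOf_realCounter hP (by omega)⟩
  · exact hsub (abcLanguage_mem_classOf_realCounter hP (by omega))
  · exact fun s hs =>
      ⟨palLanguage_mem_matrixCounterClass hk s, palLanguage_notMem_realCounterClass k hs⟩
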